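/- **Conventions.** Root systems are those of Kac--Moody theory, possibly decomposable, all of whose indecomposable components are of finite or affine type, realized in a real vector space $V$ with a symmetric bilinear form $(\cdot,\cdot)$. Thus a *set of simple roots* is a nonempty finite set $\Pi\subset V$ with $(\alpha,\alpha)>0$ for all $\alpha\in\Pi$, with $(\alpha,\beta)\le 0$ for distinct $\alpha,\beta\in\Pi$ and all $2(\alpha,\beta)/(\alpha,\alpha)\in\mathbb Z$, such that each indecomposable component $\Pi_i$ of $\Pi$ (connected component of the Dynkin diagram) is linearly independent and the form is positive semidefinite on its span; the component is of *affine* type if the form is degenerate on this span and of *finite* type otherwise. (Simple roots of different components may be linearly dependent.) The root system with simple roots $\Pi$ consists of the *real roots*, i.e. the orbit of $\Pi$ under the group generated by the reflections in elements of $\Pi$, and the *imaginary roots*, i.e. the nonzero null vectors of the root lattices $\mathbb Z\Pi_i$ (for affine $\Pi_i$: the nonzero integer multiples of the primitive null root $\delta_i$). A root system is *affine* if all its indecomposable components are of affine type. A *root subsystem* of a root system $\Delta$ is a root system $\Delta_1\subset\Delta$ such that $\alpha+\beta\in\Delta_1$ whenever $\alpha,\beta$ are real roots in $\Delta_1$ and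 $\alpha+\beta\in\Delta$. An affine component $\Pi_i$ is *untwisted with affine node* $\alpha_0\in\Pi_i$ if $\alpha_0=\delta-\theta$, where $\delta$ is orthogonal to $\Pi_i$ and $\theta$ is the highest root of the finite root system with simple roots $\Pi_i\setminus\{\alpha_0\}$ (i.e. the diagram of $\Pi_i$ is the extended Dynkin diagram of $\Pi_i\setminus\{\alpha_0\}$ with added node $\alpha_0$). **Theorem.** Let $\Delta$ be an affine root system. 1. Let $\widetilde\Delta$ be an affine root subsystem of $\Delta$, let $\Pi$ be a set of simple roots of $\widetilde\Delta$ with indecomposable components $\Pi_1,\dots,\Pi_k$, let $J\subset\{1,\dots,k\}$ be the set of indices $j$ for which $\Pi_j$ is of untwisted type, and let $J'\subset J$ be any subset. For each $j\in J'$ discard from $\Pi$ an affine node $\alpha_0^j$ of $\Pi_j$, and let $\Pi'$ be the set of remaining simple roots. Then $\Pi'$ is a set of simple roots, and the root system $\Delta'$ with simple roots $\Pi'$ is a root subsystem of $\Delta$. 2. Conversely, for every root subsystem $\Delta'$ of $\Delta$ that is not affine there is an affine root subsystem $\widetilde\Delta$ of $\Delta$ such that $\Delta'$ is obtained from $\widetilde\Delta$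 as in part 1, for some choice of $\Pi$, $J'$ and the nodes $\alpha_0^j$. -/

import Mathlib

namespace AffineRoots

variable {V : Type*} [AddCommGroup V] [Module ℝ V]

/-- The reflection `v ↦ v - (2 (v, a) / (a, a)) a`; used only for vectors with `(a, a) > 0`. -/
noncomputable def reflect (B : LinearMap.BilinForm ℝ V) (a v : V) : V :=
  v - (2 * B v a / B a a) • a

/-- A set of vectors is indecomposable if it is nonempty and is not the union of two nonempty
mutually orthogonal parts (for simple roots: the Dynkin diagram is connected). -/
def IsIndecomposable (B : LinearMap.BilinForm ℝ V) (C : Set V) : Prop :=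
  C.Nonempty ∧ ∀ T ⊆ C, T.Nonempty → (C \ T).Nonempty → ∃ a ∈ T, ∃ b ∈ C \ T, B a b ≠ 0

/-- `C` is an indecomposable component of `P` (for simple roots: the vertex set of a connected
component of the Dynkin diagram). -/
def IsComponent (B : LinearMap.BilinForm ℝ V) (P C : Set V) : Prop :=
  C ⊆ P ∧ IsIndecomposable B C ∧ ∀ a ∈ C, ∀ b ∈ P \ C, B a b = 0

/-- `P` is a set of simple roots of a (possibly decomposable) Kac--Moody root system all of whose
indecomposable components are of finite or affine type: the numbers `2 (a, b) / (a, a)` form a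
generalized Cartan matrix, and on every component the simple roots are linearly independent and
the form is positive semidefinite.  Simple roots of different components may be linearly
dependent, since affine components may have proportional imaginary roots. -/
structure IsSimpleSystem (B : LinearMap.BilinForm ℝ V) (P : Set V) : Prop where
  finite : P.Finite
  nonempty : P.Nonempty
  pos : ∀ a ∈ P, 0 < B a a
  nonpos : ∀ a ∈ P, ∀ b ∈ P, a ≠ b → B a b ≤ 0
  integral : ∀ a ∈ P, ∀ b ∈ P, ∃ n : ℤ, 2 * B a b = n * B a a
  linearIndep : ∀ C, IsComponent B P C → LinearIndepOn ℝ id C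
  semidefinite : ∀ C, IsComponent B P C → ∀ v ∈ Submodule.span ℝ C, 0 ≤ B v v

/-- The real roots of the root system with simple roots `P`: the orbit of `P` under the Weyl group,
that is, under the group generated by the (involutive) reflections in the elements of `P`. -/
inductive IsRealRoot (B : LinearMap.BilinForm ℝ V) (P : Set V) : V → Prop
  | simple {a : V} : a ∈ P → IsRealRoot B P a
  | reflect {a v : V} : a ∈ P → IsRealRoot B P v → IsRealRoot B P (reflect B a v)

/-- The imaginary roots of the root system with simple roots `P`: the nonzero null vectors in the
root lattices of the components.  A component of finite type has none; for a component of affine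
type they are the nonzero integer multiples of its primitive null root `δ`. -/
def IsImagRoot (B : LinearMap.BilinForm ℝ V) (P : Set V) (v : V) : Prop :=
  v ≠ 0 ∧ ∃ C, IsComponent B P C ∧ v ∈ AddSubgroup.closure C ∧ ∀ a ∈ C, B v a = 0

/-- The root system (real and imaginary roots) with simple roots `P`. -/
def rootSet (B : LinearMap.BilinForm ℝ V) (P : Set V) : Set V :=
  {v | IsRealRoot B P v ∨ IsImagRoot B P v}

/-- `P` is a set of simple roots of `R`. -/
def IsSimpleRootsOf (B : LinearMap.BilinForm ℝ V) (P R : Set V) : Prop :=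
  IsSimpleSystem B P ∧ rootSet B P = R

/-- `R` is a root system (with components of finite or affine type). -/
def IsRootSystem (B : LinearMap.BilinForm ℝ V) (R : Set V) : Prop :=
  ∃ P, IsSimpleRootsOf B P R

/-- A component of simple roots (on whose span the form is positive semidefinite) is of affine type
if the form is degenerate on its span, and of finite type otherwise. -/
def IsAffineType (B : LinearMap.BilinForm ℝ V) (C : Set V) : Prop :=
  ∃ v ∈ Submodule.span ℝ C, v ≠ 0 ∧ B v v = 0

/-- `R` is an affine root system, possibly decomposable: all its components are of affine type. -/
def IsAffineRootSystem (B : LinearMap.BilinForm ℝ V) (R : Set V) : Prop :=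
  ∃ P, IsSimpleRootsOf B P R ∧ ∀ C, IsComponent B P C → IsAffineType B C

/-- `S` is a root subsystem of `R`: a root system contained in `R` such that, whenever the sum of
two real roots of `S` is a root (real or imaginary) of `R`, it is a root of `S`.  The real roots
are those with `(a, a) ≠ 0`. -/
structure IsRootSubsystem (B : LinearMap.BilinForm ℝ V) (S R : Set V) : Prop where
  isRootSystem : IsRootSystem B S
  subset : S ⊆ R
  closed : ∀ a ∈ S, ∀ b ∈ S, B a a ≠ 0 → B b b ≠ 0 → a + b ∈ R → a + b ∈ S

/-- `t` is the highest root of the finite root system with simple roots `P`. -/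
def IsHighestRoot (B : LinearMap.BilinForm ℝ V) (P : Set V) (t : V) : Prop :=
  IsRealRoot B P t ∧ ∀ v, IsRealRoot B P v → t - v ∈ AddSubmonoid.closure P

/-- The affine component `C` of simple roots is of untwisted type, with affine node `a = α₀`:
`α₀ = δ - θ`, where `δ` is null and `θ` is the highest root of the finite root system whose
simple roots are the other elements of `C`.  Thus the diagram of `C` is the extended Dynkin
diagram of `C \ {a}`, with `a` the added node. -/
def IsUntwistedWithNode (B : LinearMap.BilinForm ℝ V) (C : Set V) (a : V) : Prop :=
  a ∈ C ∧ ∃ t, IsHighestRoot B (C \ {a}) t ∧ ∀ c ∈ C, B (a + t) c = 0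

/-- `P'` arises from the simple roots `P` as follows: choose a set `J` of untwisted components
of `P`, and discard from `P` the affine node `node C` of every `C ∈ J`. -/
def DiscardsAffineNodes (B : LinearMap.BilinForm ℝ V) (P P' : Set V) : Prop :=
  ∃ (J : Set (Set V)) (node : Set V → V),
    (∀ C ∈ J, IsComponent B P C ∧ IsUntwistedWithNode B C (node C)) ∧ P' = P \ (node '' J)

end AffineRoots

/-!
Everything rests on a description of the real roots by their coordinates.  Let `S` be an
indecomposable set of simple roots of finite or affine type.  A vector `v = ∑ n c • c` of positive
norm with integers `n c` is a real root if and only if its coroot `2 v / (v, v)` is an integral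
combination of the simple coroots, that is, if and only if all `n c (c, c) / (v, v)` are integers
(`IsRealRoot.exists_isRootCoord`, `IsRootCoord.isRealRoot`).  Such a vector is positive or negative:
the norms of its positive and negative parts are multiples of `(v, v)` with sum at most `(v, v)`,
so one of the parts is null; it is zero or has full support, and then the other part is zero
(`IsRootCoord.nonneg_or_nonpos`).  Simple reflections then lower the height of a positive `v` until a
simple root is reached.

Discarding nodes: a root of the big system that lies in the lattice of the remaining simple roots
satisfies the coordinate criterion there, so it is a root of the small system.  Hence the real roots
generated by any nonempty subset of the simple roots are closed under sums
(`add_mem_rootSet_of_subset`).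

Conversely, a component `F` of the subsystem lies in one affine component `C` of the ambient system
(`IsComponent.exists_ambient`).  By the coordinate criterion, a multiple `ε` of the null root of `C`
is a period of the real roots of `C` (`exists_period`).  If `F` is of finite type with highest root
`θ`, then `F ∪ {ε - θ}` is of untwisted affine type with real roots `b + j ε`, for `b` a root of `F`
(`IsFiniteBase.exists_isAffineHull`).  Since `ε` is a period, enlarging all components of finite type
in this way preserves closedness in the ambient system (`exists_affine_envelope`), and discarding
the new nodes gives back the subsystem.
-/

namespace AffineRoots

variable {V : Type*} [AddCommGroup V] [Module ℝ V] {B : LinearMap.BilinForm ℝ V}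

/-! ### Semidefinite forms and reflections -/

lemma sq_le_mul_of_semidefinite (hB : B.IsSymm) {W : Submodule ℝ V}
    (hW : ∀ v ∈ W, 0 ≤ B v v) {v w : V} (hv : v ∈ W) (hw : w ∈ W) :
    B v w ^ 2 ≤ B v v * B w w := by
  have key : ∀ t : ℝ, 0 ≤ B w w * (t * t) + (2 * B v w) * t + B v v := by
    intro t
    have h := hW (v + t • w) (W.add_mem hv (W.smul_mem t hw))
    have hs : B w v = B v w := hB.eq w v
    simp only [map_add, map_smul, LinearMap.add_apply, LinearMap.smul_apply, smul_eq_mul, hs] at h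
    linarith
  have h := discrim_le_zero key
  unfold discrim at h
  linarith

lemma eq_zero_of_null (hB : B.IsSymm) {W : Submodule ℝ V}
    (hW : ∀ v ∈ W, 0 ≤ B v v) {v w : V} (hv : v ∈ W) (hw : w ∈ W) (h0 : B v v = 0) :
    B v w = 0 := by
  have h := sq_le_mul_of_semidefinite hB hW hv hw
  rw [h0, zero_mul] at h
  exact pow_eq_zero_iff (two_ne_zero) |>.1 (le_antisymm h (sq_nonneg _))

lemma apply_eq_zero_of_mem_span {S : Set V} {v w : V} (h : ∀ c ∈ S, B v c = 0)
    (hw : w ∈ Submodule.span ℝ S) : B v w = 0 := by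
  have : Submodule.span ℝ S ≤ LinearMap.ker (B v) :=
    Submodule.span_le.2 fun c hc => h c hc
  exact this hw

lemma mem_span_of_mem_closure {S : Set V} {v : V} (h : v ∈ AddSubgroup.closure S) :
    v ∈ Submodule.span ℝ S := by
  have : AddSubgroup.closure S ≤ (Submodule.span ℝ S).toAddSubgroup :=
    (AddSubgroup.closure_le _).2 Submodule.subset_span
  exact this h

lemma reflect_self {a : V} (ha : B a a ≠ 0) : reflect B a a = -a := by
  have : 2 * B a a / B a a = 2 := by field_simp
  rw [reflect, this, two_smul]; abel

lemma reflect_eq_self {a v : V} (h : B v a = 0) : reflect B a v = v := by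
  simp [reflect, h]

lemma reflect_neg (a v : V) : reflect B a (-v) = -reflect B a v := by
  simp only [reflect, map_neg, LinearMap.neg_apply, mul_neg, neg_div, neg_smul]; abel

lemma reflect_add (a v w : V) : reflect B a (v + w) = reflect B a v + reflect B a w := by
  simp only [reflect, map_add, LinearMap.add_apply, mul_add, add_div, add_smul]; abel

lemma reflect_smul (a : V) (r : ℝ) (v : V) : reflect B a (r • v) = r • reflect B a v := by
  simp only [reflect, map_smul, LinearMap.smul_apply, smul_eq_mul, smul_sub, smul_smul]
  congr 2; ring

lemma apply_reflect_reflect (hB : B.IsSymm) {a : V} (ha : B a a ≠ 0) (v w : V) :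
    B (reflect B a v) (reflect B a w) = B v w := by
  have hs : B a w = B w a := hB.eq a w
  simp only [reflect, map_sub, map_smul, LinearMap.sub_apply, LinearMap.smul_apply, smul_eq_mul, hs]
  field_simp
  ring

lemma reflect_reflect {a : V} (ha : B a a ≠ 0) (v : V) : reflect B a (reflect B a v) = v := by
  have : 2 * B (reflect B a v) a / B a a = -(2 * B v a / B a a) := by
    simp only [reflect, map_sub, map_smul, LinearMap.sub_apply, LinearMap.smul_apply, smul_eq_mul]
    field_simp
    ring
  rw [reflect, this, neg_smul, reflect]; abel

lemma reflect_conj (hB : B.IsSymm) {a : V} (ha : B a a ≠ 0) (b v : V) :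
    reflect B (reflect B a b) v = reflect B a (reflect B b (reflect B a v)) := by
  have h1 : B v (reflect B a b) = B (reflect B a v) b := by
    rw [← apply_reflect_reflect hB ha v, reflect_reflect ha]
  have h2 : reflect B a (reflect B a v - (2 * B (reflect B a v) b / B b b) • b) =
      v - (2 * B (reflect B a v) b / B b b) • reflect B a b := by
    rw [sub_eq_add_neg, ← neg_smul, reflect_add, reflect_reflect ha, reflect_smul, neg_smul,
      ← sub_eq_add_neg]
  rw [reflect, h1, apply_reflect_reflect hB ha, ← h2]
  rfl

/-! ### Real roots -/

lemma IsRealRoot.mono {P Q : Set V} (h : P ⊆ Q) {v : V} (hv : IsRealRoot B P v) :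
    IsRealRoot B Q v := by
  induction hv with
  | simple ha => exact .simple (h ha)
  | reflect ha _ ih => exact .reflect (h ha) ih

lemma IsRealRoot.mem_span {P : Set V} {v : V} (hv : IsRealRoot B P v) :
    v ∈ Submodule.span ℝ P := by
  induction hv with
  | simple ha => exact Submodule.subset_span ha
  | reflect ha _ ih =>
    exact Submodule.sub_mem _ ih (Submodule.smul_mem _ _ (Submodule.subset_span ha))

lemma IsRealRoot.neg {P : Set V} (hP : ∀ a ∈ P, 0 < B a a) {v : V} (hv : IsRealRoot B P v) :
    IsRealRoot B P (-v) := by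
  induction hv with
  | simple ha =>
    rw [← reflect_self (hP _ ha).ne']
    exact .reflect ha (.simple ha)
  | reflect ha _ ih =>
    rw [← reflect_neg]
    exact .reflect ha ih

lemma IsRealRoot.apply_self (hB : B.IsSymm) {P : Set V} (hP : ∀ a ∈ P, 0 < B a a) {v : V}
    (hv : IsRealRoot B P v) : ∃ a ∈ P, B v v = B a a := by
  induction hv with
  | simple ha => exact ⟨_, ha, rfl⟩
  | reflect ha _ ih => rwa [apply_reflect_reflect hB (hP _ ha).ne']

lemma IsRealRoot.pos (hB : B.IsSymm) {P : Set V} (hP : ∀ a ∈ P, 0 < B a a) {v : V}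
    (hv : IsRealRoot B P v) : 0 < B v v := by
  obtain ⟨a, ha, h⟩ := hv.apply_self hB hP
  rw [h]; exact hP a ha

lemma IsRealRoot.reflect_root (hB : B.IsSymm) {P : Set V} (hP : ∀ a ∈ P, 0 < B a a) {b v : V}
    (hb : IsRealRoot B P b) (hv : IsRealRoot B P v) :
    IsRealRoot B P (AffineRoots.reflect B b v) := by
  induction hb generalizing v with
  | simple ha => exact .reflect ha hv
  | reflect ha _ ih =>
    rw [reflect_conj hB (hP _ ha).ne']
    exact .reflect ha (ih (.reflect ha hv))

/-! ### Integral coordinates of real roots -/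

/-- A finite set of simple roots with semidefinite form, in which every null combination with
nonnegative coefficients is zero or has full support.  This holds for the indecomposable sets of
finite or affine type (`isCartanBase_of_isIndecomposable`) and for all subsets of these
(`IsCartanBase.mono`). -/
structure IsCartanBase (B : LinearMap.BilinForm ℝ V) (S : Finset V) : Prop where
  pos : ∀ a ∈ S, 0 < B a a
  nonpos : ∀ a ∈ S, ∀ b ∈ S, a ≠ b → B a b ≤ 0
  integral : ∀ a ∈ S, ∀ b ∈ S, ∃ n : ℤ, 2 * B a b = n * B a a
  semidefinite : ∀ v ∈ Submodule.span ℝ (S : Set V), 0 ≤ B v v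
  full_support : ∀ n : V → ℤ, (∀ c ∈ S, 0 ≤ n c) →
    B (∑ c ∈ S, n c • c) (∑ c ∈ S, n c • c) = 0 → (∀ c ∈ S, n c = 0) ∨ ∀ c ∈ S, 0 < n c

/-- The integers `n` are coordinates of `v` with respect to `S` for which the coroot
`2 v / (v, v)` has integral coordinates `n c * (c, c) / (v, v)` with respect to the simple
coroots. -/
structure IsRootCoord (B : LinearMap.BilinForm ℝ V) (S : Finset V) (v : V) (n : V → ℤ) : Prop where
  pos : 0 < B v v
  eq_sum : v = ∑ c ∈ S, n c • c
  dual : ∀ c ∈ S, ∃ m : ℤ, n c * B c c = m * B v v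

omit [Module ℝ V] in
lemma sum_zsmul_mem_closure (S : Finset V) (n : V → ℤ) :
    ∑ c ∈ S, n c • c ∈ AddSubgroup.closure (S : Set V) :=
  sum_mem fun _ hc => zsmul_mem (AddSubgroup.subset_closure hc) _

lemma sum_zsmul_mem_span (S : Finset V) (n : V → ℤ) :
    ∑ c ∈ S, n c • c ∈ Submodule.span ℝ (S : Set V) :=
  mem_span_of_mem_closure (sum_zsmul_mem_closure S n)

lemma apply_sum_zsmul (v : V) (S : Finset V) (n : V → ℤ) :
    B v (∑ c ∈ S, n c • c) = ∑ c ∈ S, n c * B v c := by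
  rw [map_sum]
  refine Finset.sum_congr rfl fun c _ => ?_
  rw [map_zsmul, zsmul_eq_mul]

lemma sum_zsmul_apply (v : V) (S : Finset V) (n : V → ℤ) :
    B (∑ c ∈ S, n c • c) v = ∑ c ∈ S, n c * B c v := by
  rw [map_sum, LinearMap.sum_apply]
  refine Finset.sum_congr rfl fun c _ => ?_
  rw [map_zsmul, LinearMap.smul_apply, zsmul_eq_mul]

omit [Module ℝ V] in
lemma mem_closure_finset_iff {S : Finset V} {v : V} :
    v ∈ AddSubgroup.closure (S : Set V) ↔ ∃ n : V → ℤ, v = ∑ c ∈ S, n c • c := by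
  constructor
  · intro h
    rw [← Submodule.span_int_eq_addSubgroupClosure] at h
    obtain ⟨n, -, hn⟩ := Submodule.mem_span_finset.1 (show v ∈ Submodule.span ℤ (S : Set V) from h)
    exact ⟨n, hn.symm⟩
  · rintro ⟨n, rfl⟩
    exact sum_zsmul_mem_closure S n

/-- If the coordinates of a vector are integral on both the simple roots and, after scaling by `k`,
the simple coroots, then its norm is a multiple of `k`. -/
lemma norm_mem_zmultiples (hB : B.IsSymm) {S : Finset V}
    (hint : ∀ a ∈ S, ∀ b ∈ S, ∃ n : ℤ, 2 * B a b = n * B a a) {n : V → ℤ} {k : ℝ}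
    (h : ∀ c ∈ S, ∃ m : ℤ, n c * B c c = m * k) :
    ∃ m : ℤ, B (∑ c ∈ S, n c • c) (∑ c ∈ S, n c • c) = m * k := by
  classical
  induction S using Finset.induction_on with
  | empty => exact ⟨0, by simp⟩
  | insert a T ha ih =>
    obtain ⟨p, hp⟩ := ih (fun x hx y hy => hint x (Finset.mem_insert_of_mem hx) y
      (Finset.mem_insert_of_mem hy)) (fun c hc => h c (Finset.mem_insert_of_mem hc))
    obtain ⟨q, hq⟩ := h a (Finset.mem_insert_self a T)
    have hcross : ∃ r : ℤ, 2 * (n a * B a (∑ c ∈ T, n c • c)) = r * k := by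
      choose! e he using fun b (hb : b ∈ T) =>
        hint a (Finset.mem_insert_self a T) b (Finset.mem_insert_of_mem hb)
      refine ⟨∑ c ∈ T, n c * e c * q, ?_⟩
      rw [apply_sum_zsmul, Finset.mul_sum, Finset.mul_sum]
      push_cast
      rw [Finset.sum_mul]
      refine Finset.sum_congr rfl fun c hc => ?_
      linear_combination (n a * n c : ℝ) * he c hc + (n c * e c : ℝ) * hq
    obtain ⟨r, hr⟩ := hcross
    refine ⟨p + r + n a * q, ?_⟩
    rw [Finset.sum_insert ha]
    simp only [map_add, LinearMap.add_apply, map_zsmul, LinearMap.smul_apply, zsmul_eq_mul]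
    rw [hp, hB.eq (∑ c ∈ T, n c • c) a]
    push_cast
    linear_combination hr + (n a : ℝ) * hq

omit [Module ℝ V] in
lemma sum_max_sub_sum_max (S : Finset V) (n : V → ℤ) :
    ∑ c ∈ S, n c • c = ∑ c ∈ S, max (n c) 0 • c - ∑ c ∈ S, max (-n c) 0 • c := by
  rw [← Finset.sum_sub_distrib]
  refine Finset.sum_congr rfl fun c _ => ?_
  rw [← sub_smul]
  congr 1
  rcases le_total (n c) 0 with h | h
  · rw [max_eq_right h, max_eq_left (by linarith)]; ring
  · rw [max_eq_left h, max_eq_right (by linarith)]; ring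

lemma apply_posPart_negPart_nonpos {S : Finset V}
    (hS : ∀ a ∈ S, ∀ b ∈ S, a ≠ b → B a b ≤ 0) (n : V → ℤ) :
    B (∑ c ∈ S, max (n c) 0 • c) (∑ c ∈ S, max (-n c) 0 • c) ≤ 0 := by
  rw [sum_zsmul_apply]
  refine Finset.sum_nonpos fun c hc => ?_
  rw [apply_sum_zsmul, Finset.mul_sum]
  refine Finset.sum_nonpos fun d hd => ?_
  have h1 : (0 : ℝ) ≤ (max (n c) 0 : ℤ) := by exact_mod_cast le_max_right _ _
  have h2 : (0 : ℝ) ≤ (max (-n d) 0 : ℤ) := by exact_mod_cast le_max_right _ _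
  by_cases hcd : c = d
  · subst hcd
    rcases le_total (n c) 0 with h | h
    · rw [max_eq_right h]; simp
    · rw [max_eq_right (a := -n c) (by linarith)]; simp
  · exact mul_nonpos_of_nonneg_of_nonpos h1 (mul_nonpos_of_nonneg_of_nonpos h2 (hS c hc d hd hcd))

/-- The norm of a vector is at least the sum of the norms of its positive and negative parts. -/
lemma norm_posPart_add_norm_negPart_le (hB : B.IsSymm) {S : Finset V}
    (hS : ∀ a ∈ S, ∀ b ∈ S, a ≠ b → B a b ≤ 0) (n : V → ℤ) :
    B (∑ c ∈ S, max (n c) 0 • c) (∑ c ∈ S, max (n c) 0 • c) +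
      B (∑ c ∈ S, max (-n c) 0 • c) (∑ c ∈ S, max (-n c) 0 • c) ≤
      B (∑ c ∈ S, n c • c) (∑ c ∈ S, n c • c) := by
  have h := apply_posPart_negPart_nonpos hS n
  rw [sum_max_sub_sum_max S n]
  set x := ∑ c ∈ S, max (n c) 0 • c
  set y := ∑ c ∈ S, max (-n c) 0 • c
  have hs : B y x = B x y := hB.eq y x
  simp only [map_sub, LinearMap.sub_apply, hs]
  linarith

/-- A vector with root coordinates is positive or negative: the norms of its positive and negative
parts are multiples of `(v, v)` whose sum is at most `(v, v)`, so one of the parts is null.  It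
vanishes or has full support, and in the latter case the other part vanishes. -/
lemma IsRootCoord.nonneg_or_nonpos (hB : B.IsSymm) {S : Finset V} (hS : IsCartanBase B S) {v : V}
    {n : V → ℤ} (h : IsRootCoord B S v n) : (∀ c ∈ S, 0 ≤ n c) ∨ ∀ c ∈ S, n c ≤ 0 := by
  have hp : ∃ m : ℤ, B (∑ c ∈ S, max (n c) 0 • c) (∑ c ∈ S, max (n c) 0 • c) = m * B v v := by
    refine norm_mem_zmultiples hB hS.integral fun c hc => ?_
    rcases le_total (n c) 0 with h0 | h0
    · exact ⟨0, by rw [max_eq_right h0]; simp⟩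
    · rw [max_eq_left h0]; exact h.dual c hc
  have hn : ∃ m : ℤ, B (∑ c ∈ S, max (-n c) 0 • c) (∑ c ∈ S, max (-n c) 0 • c) = m * B v v := by
    refine norm_mem_zmultiples hB hS.integral fun c hc => ?_
    rcases le_total (n c) 0 with h0 | h0
    · obtain ⟨m, hm⟩ := h.dual c hc
      refine ⟨-m, ?_⟩
      rw [max_eq_left (by linarith)]; push_cast; linear_combination -hm
    · exact ⟨0, by rw [max_eq_right (a := -n c) (by linarith)]; simp⟩
  obtain ⟨p, hp⟩ := hp
  obtain ⟨q, hq⟩ := hn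
  have hle := norm_posPart_add_norm_negPart_le hB hS.nonpos n
  rw [← h.eq_sum] at hle
  have hp0 : 0 ≤ (p : ℝ) := by
    have := hS.semidefinite _ (sum_zsmul_mem_span S fun c => max (n c) 0)
    rw [hp] at this
    exact nonneg_of_mul_nonneg_left this h.pos
  have hq0 : 0 ≤ (q : ℝ) := by
    have := hS.semidefinite _ (sum_zsmul_mem_span S fun c => max (-n c) 0)
    rw [hq] at this
    exact nonneg_of_mul_nonneg_left this h.pos
  have hpq : (p : ℝ) + q ≤ 1 := by
    rw [hp, hq, ← add_mul] at hle
    exact le_of_mul_le_mul_right (by linarith) h.pos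
  have hpq' : p = 0 ∨ q = 0 := by
    norm_cast at hp0 hq0 hpq
    omega
  rcases hpq' with h0 | h0
  · rw [h0, Int.cast_zero, zero_mul] at hp
    rcases hS.full_support (fun c => max (n c) 0) (fun c _ => le_max_right _ _) hp with h1 | h1
    · exact .inr fun c hc => by have := h1 c hc; simp only [max_eq_right_iff] at this; exact this
    · exact .inl fun c hc => by
        have := h1 c hc
        simp only [lt_max_iff, lt_irrefl, or_false] at this
        exact this.le
  · rw [h0, Int.cast_zero, zero_mul] at hq
    rcases hS.full_support (fun c => max (-n c) 0) (fun c _ => le_max_right _ _) hq with h1 | h1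
    · exact .inl fun c hc => by have := h1 c hc; simp only [max_eq_right_iff] at this; linarith
    · exact .inr fun c hc => by
        have := h1 c hc; simp only [lt_max_iff, lt_irrefl, or_false] at this; linarith

omit [Module ℝ V] in
lemma sum_update_zsmul {S : Finset V} [DecidableEq V] (n : V → ℤ) {a : V} (ha : a ∈ S) (p : ℤ) :
    ∑ c ∈ S, (n - Pi.single a p : V → ℤ) c • c = ∑ c ∈ S, n c • c - p • a := by
  simp only [Pi.sub_apply, sub_smul, Finset.sum_sub_distrib]
  congr 1
  rw [Finset.sum_eq_single a]
  · simp
  · intro b _ hb; simp [Pi.single_eq_of_ne hb]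
  · exact fun h => absurd ha h

/-- The numbers `2 (v, u) / (v, v)` are integers if `v` has root coordinates and `u` is in the
root lattice. -/
lemma IsRootCoord.exists_int {S : Finset V}
    (hint : ∀ a ∈ S, ∀ b ∈ S, ∃ n : ℤ, 2 * B a b = n * B a a) {v : V} {n : V → ℤ}
    (h : IsRootCoord B S v n) {u : V} (hu : u ∈ AddSubgroup.closure (S : Set V)) :
    ∃ q : ℤ, 2 * B v u = q * B v v := by
  induction hu using AddSubgroup.closure_induction with
  | mem a ha =>
    choose! e he using fun b (hb : b ∈ S) => hint b hb a ha
    choose! m hm using h.dual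
    refine ⟨∑ c ∈ S, m c * e c, ?_⟩
    conv_lhs => rw [h.eq_sum]
    rw [sum_zsmul_apply, Finset.mul_sum]
    push_cast
    rw [Finset.sum_mul]
    refine Finset.sum_congr rfl fun c hc => ?_
    linear_combination (n c : ℝ) * he c hc + (e c : ℝ) * hm c hc
  | zero => exact ⟨0, by simp⟩
  | add x y _ _ hx hy =>
    obtain ⟨p, hp⟩ := hx
    obtain ⟨q, hq⟩ := hy
    exact ⟨p + q, by rw [map_add]; push_cast; linear_combination hp + hq⟩
  | neg x _ hx =>
    obtain ⟨p, hp⟩ := hx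
    exact ⟨-p, by rw [map_neg]; push_cast; linear_combination -hp⟩

/-- Simple reflections preserve root coordinates, and change only one of them. -/
lemma IsRootCoord.reflect (hB : B.IsSymm) {S : Finset V} [DecidableEq V]
    (hpos : ∀ a ∈ S, 0 < B a a)
    (hint : ∀ a ∈ S, ∀ b ∈ S, ∃ n : ℤ, 2 * B a b = n * B a a) {v : V}
    {n : V → ℤ} (h : IsRootCoord B S v n) {a : V} (ha : a ∈ S) :
    ∃ p : ℤ, 2 * B v a = p * B a a ∧
      IsRootCoord B S (AffineRoots.reflect B a v) (n - Pi.single a p) := by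
  have ha0 := (hpos a ha).ne'
  choose! e he using fun b (hb : b ∈ S) => hint a ha b hb
  choose! m hm using h.dual
  have hp : 2 * B v a = (∑ c ∈ S, n c * e c : ℤ) * B a a := by
    conv_lhs => rw [h.eq_sum]
    rw [sum_zsmul_apply, Finset.mul_sum]
    push_cast
    rw [Finset.sum_mul]
    refine Finset.sum_congr rfl fun c hc => ?_
    rw [hB.eq c a]
    linear_combination (n c : ℝ) * he c hc
  obtain ⟨q, hq⟩ := h.exists_int hint (AddSubgroup.subset_closure ha)
  refine ⟨_, hp, ?_, ?_, ?_⟩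
  · rw [apply_reflect_reflect hB ha0]; exact h.pos
  · rw [sum_update_zsmul n ha, ← h.eq_sum, AffineRoots.reflect, hp, mul_div_assoc, div_self ha0,
      mul_one, Int.cast_smul_eq_zsmul]
  · intro c hc
    rw [apply_reflect_reflect hB ha0]
    by_cases hca : c = a
    · subst hca
      refine ⟨m c - q, ?_⟩
      rw [Pi.sub_apply, Pi.single_eq_same, Int.cast_sub, sub_mul, ← hp, hq, hm c hc]
      push_cast; ring
    · refine ⟨m c, ?_⟩
      rw [Pi.sub_apply, Pi.single_eq_of_ne hca, sub_zero, hm c hc]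

lemma IsRealRoot.exists_isRootCoord (hB : B.IsSymm) {S : Finset V}
    (hpos : ∀ a ∈ S, 0 < B a a)
    (hint : ∀ a ∈ S, ∀ b ∈ S, ∃ n : ℤ, 2 * B a b = n * B a a) {v : V}
    (hv : IsRealRoot B (S : Set V) v) : ∃ n, IsRootCoord B S v n := by
  classical
  induction hv with
  | @simple a ha =>
    refine ⟨Pi.single a 1, hpos a ha, ?_, ?_⟩
    · rw [Finset.sum_eq_single a]
      · simp
      · intro b _ hb; simp [Pi.single_eq_of_ne hb]
      · exact fun h => absurd ha h
    · intro c _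
      by_cases hca : c = a
      · subst hca; exact ⟨1, by simp⟩
      · exact ⟨0, by simp [Pi.single_eq_of_ne hca]⟩
  | @reflect a v ha _ ih =>
    obtain ⟨n, hn⟩ := ih
    obtain ⟨p, -, h⟩ := hn.reflect hB hpos hint ha
    exact ⟨_, h⟩

lemma IsRootCoord.neg {S : Finset V} {v : V} {n : V → ℤ} (h : IsRootCoord B S v n) :
    IsRootCoord B S (-v) (-n) := by
  have hv : B (-v) (-v) = B v v := by simp
  refine ⟨by rw [hv]; exact h.pos, ?_, fun c hc => ?_⟩
  · conv_lhs => rw [h.eq_sum]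
    simp [Finset.sum_neg_distrib]
  · obtain ⟨m, hm⟩ := h.dual c hc
    refine ⟨-m, ?_⟩
    rw [hv]; push_cast; simp only [Pi.neg_apply]; push_cast; linear_combination -hm

/-- A vector with root coordinates is a real root: as long as it is not simple, some simple
reflection lowers its height and keeps it positive. -/
lemma IsRootCoord.isRealRoot (hB : B.IsSymm) {S : Finset V} (hS : IsCartanBase B S) {v : V}
    {n : V → ℤ} (h : IsRootCoord B S v n) : IsRealRoot B (S : Set V) v := by
  classical
  suffices H : ∀ (k : ℕ) (v : V) (n : V → ℤ), IsRootCoord B S v n → (∀ c ∈ S, 0 ≤ n c) →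
      ∑ c ∈ S, n c ≤ k → IsRealRoot B (S : Set V) v by
    rcases h.nonneg_or_nonpos hB hS with h0 | h0
    · exact H (∑ c ∈ S, n c).toNat v n h h0 (Int.self_le_toNat _)
    · have := H (∑ c ∈ S, (-n) c).toNat (-v) (-n) h.neg
        (fun c hc => by have := h0 c hc; simp only [Pi.neg_apply]; linarith) (Int.self_le_toNat _)
      simpa using this.neg hS.pos
  intro k
  induction k with
  | zero =>
    intro v n h h0 hk
    have hz := (Finset.sum_eq_zero_iff_of_nonneg h0).1
      (le_antisymm (by exact_mod_cast hk) (Finset.sum_nonneg h0))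
    have : v = 0 := by
      rw [h.eq_sum]; exact Finset.sum_eq_zero fun c hc => by rw [hz c hc, zero_smul]
    have h1 := h.pos
    simp [this] at h1
  | succ k ih =>
    intro v n h h0 hk
    obtain ⟨c, hc, hcpos⟩ : ∃ c ∈ S, 0 < n c * B v c := by
      by_contra! hcon
      have h1 := Finset.sum_nonpos hcon
      rw [← apply_sum_zsmul, ← h.eq_sum] at h1
      exact absurd h.pos (not_lt.2 h1)
    have hnc : (0 : ℝ) ≤ n c := by exact_mod_cast h0 c hc
    have hvc : 0 < B v c := pos_of_mul_pos_right hcpos hnc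
    obtain ⟨p, hp, hr⟩ := h.reflect hB hS.pos hS.integral hc
    have hp0 : 0 < p := by
      have : (0 : ℝ) < p * B c c := by rw [← hp]; linarith
      exact_mod_cast pos_of_mul_pos_left this (hS.pos c hc).le
    rcases hr.nonneg_or_nonpos hB hS with h1 | h1
    · rw [← reflect_reflect (hS.pos c hc).ne' v]
      refine .reflect hc (ih _ _ hr h1 ?_)
      simp only [Pi.sub_apply, Finset.sum_sub_distrib]
      rw [Finset.sum_eq_single c (f := fun x => (Pi.single c p : V → ℤ) x)
        (fun b _ hb => by simp [Pi.single_eq_of_ne hb]) (fun h => absurd hc h)]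
      simp only [Pi.single_eq_same]
      push_cast at hk
      linarith
    · have hz : ∀ d ∈ S, d ≠ c → n d = 0 := fun d hd hdc => by
        have := h1 d hd
        rw [Pi.sub_apply, Pi.single_eq_of_ne hdc, sub_zero] at this
        exact le_antisymm this (h0 d hd)
      have hvn : v = n c • c := by
        conv_lhs => rw [h.eq_sum]
        exact Finset.sum_eq_single c (fun d hd hdc => by rw [hz d hd hdc, zero_smul])
          (fun h => absurd hc h)
      obtain ⟨m, hm⟩ := h.dual c hc
      have hvv : B v v = n c * n c * B c c := by
        rw [hvn]; simp only [map_zsmul, LinearMap.smul_apply, zsmul_eq_mul]; ring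
      have hn0 : (n c : ℝ) ≠ 0 := fun h => by simp [h] at hcpos
      have hone : (n c : ℝ) * m = 1 := by
        have h2 : (n c : ℝ) * B c c * (n c * m) = (n c * B c c) * 1 := by
          rw [hvv] at hm; linear_combination -hm
        exact mul_left_cancel₀ (mul_ne_zero hn0 (hS.pos c hc).ne') h2
      have hone' : n c * m = 1 := by exact_mod_cast hone
      have : n c = 1 := Int.eq_one_or_neg_one_of_mul_eq_one hone' |>.resolve_right fun h => by
        have := h0 c hc; omega
      rw [hvn, this, one_smul]
      exact .simple hc

/-! ### Components -/

lemma exists_isComponent (hB : B.IsSymm) {P : Set V} {a : V} (ha : a ∈ P) :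
    ∃ C, IsComponent B P C ∧ a ∈ C := by
  -- the component is the smallest subset containing `a` that is orthogonal to its complement
  let 𝒯 : Set (Set V) := {T | T ⊆ P ∧ a ∈ T ∧ ∀ x ∈ T, ∀ y ∈ P \ T, B x y = 0}
  have hP : P ∈ 𝒯 := ⟨subset_rfl, ha, fun x _ y hy => absurd hy.1 hy.2⟩
  have hCP : ⋂₀ 𝒯 ⊆ P := Set.sInter_subset_of_mem hP
  have haC : a ∈ ⋂₀ 𝒯 := fun T hT => hT.2.1
  have horth : ∀ x ∈ ⋂₀ 𝒯, ∀ y ∈ P \ ⋂₀ 𝒯, B x y = 0 := by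
    rintro x hx y ⟨hyP, hy⟩
    simp only [Set.mem_sInter, not_forall] at hy
    obtain ⟨T, hT, hyT⟩ := hy
    exact hT.2.2 x (hx T hT) y ⟨hyP, hyT⟩
  refine ⟨⋂₀ 𝒯, ⟨hCP, ⟨⟨a, haC⟩, fun T hT hTne hne => ?_⟩, horth⟩, haC⟩
  by_contra! hcon
  by_cases haT : a ∈ T
  · have hmem : T ∈ 𝒯 := by
      refine ⟨hT.trans hCP, haT, fun x hx y hy => ?_⟩
      by_cases hyC : y ∈ ⋂₀ 𝒯
      · exact hcon x hx y ⟨hyC, hy.2⟩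
      · exact horth x (hT hx) y ⟨hy.1, hyC⟩
    obtain ⟨b, hb, hbT⟩ := hne
    exact hbT (hb T hmem)
  · have hmem : ⋂₀ 𝒯 \ T ∈ 𝒯 := by
      refine ⟨Set.sdiff_subset.trans hCP, ⟨haC, haT⟩, fun x hx y hy => ?_⟩
      by_cases hyC : y ∈ ⋂₀ 𝒯
      · have hyT : y ∈ T := by by_contra h; exact hy.2 ⟨hyC, h⟩
        rw [hB.eq x y]
        exact hcon y hyT x hx
      · exact horth x hx.1 y ⟨hy.1, hyC⟩
    obtain ⟨b, hb⟩ := hTne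
    exact ((hT hb) _ hmem).2 hb

lemma IsComponent.subset_of_isIndecomposable {P C D : Set V} (hC : IsComponent B P C)
    (hD : IsIndecomposable B D) (hDP : D ⊆ P) (hne : (D ∩ C).Nonempty) : D ⊆ C := by
  by_contra hcon
  obtain ⟨x, hx, hxC⟩ := Set.not_subset.1 hcon
  obtain ⟨a, ha, b, hb, hab⟩ := hD.2 (D ∩ C) Set.inter_subset_left hne ⟨x, hx, fun h => hxC h.2⟩
  exact hab (hC.2.2 a ha.2 b ⟨hDP hb.1, fun h => hb.2 ⟨hb.1, h⟩⟩)

lemma IsComponent.eq_of_mem {P C D : Set V} (hC : IsComponent B P C) (hD : IsComponent B P D)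
    {a : V} (haC : a ∈ C) (haD : a ∈ D) : C = D :=
  (hD.subset_of_isIndecomposable hC.2.1 hC.1 ⟨a, haC, haD⟩).antisymm
    (hC.subset_of_isIndecomposable hD.2.1 hD.1 ⟨a, haD, haC⟩)

lemma IsComponent.orthogonal (hB : B.IsSymm) {P C D : Set V} (hC : IsComponent B P C)
    (hD : IsComponent B P D) (hne : C ≠ D) {v w : V} (hv : v ∈ Submodule.span ℝ C)
    (hw : w ∈ Submodule.span ℝ D) : B v w = 0 := by
  refine apply_eq_zero_of_mem_span (fun d hd => ?_) hw
  rw [hB.eq v d]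
  refine apply_eq_zero_of_mem_span (fun c hc => ?_) hv
  rw [hB.eq d c]
  exact hC.2.2 c hc d ⟨hD.1 hd, fun h => hne (hC.eq_of_mem hD h hd)⟩

lemma IsRealRoot.exists_isComponent (hB : B.IsSymm) {P : Set V} {v : V} (hv : IsRealRoot B P v) :
    ∃ C, IsComponent B P C ∧ IsRealRoot B C v := by
  induction hv with
  | simple ha =>
    obtain ⟨C, hC, haC⟩ := AffineRoots.exists_isComponent hB ha
    exact ⟨C, hC, .simple haC⟩
  | @reflect a v ha _ ih =>
    obtain ⟨C, hC, hv⟩ := ih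
    refine ⟨C, hC, ?_⟩
    by_cases haC : a ∈ C
    · exact .reflect haC hv
    · rw [reflect_eq_self]
      · exact hv
      · rw [hB.eq v a]
        refine apply_eq_zero_of_mem_span (fun c hc => ?_) hv.mem_span
        rw [hB.eq a c]
        exact hC.2.2 c hc a ⟨ha, haC⟩

lemma IsComponent.pos {P C : Set V} (hP : IsSimpleSystem B P) (hC : IsComponent B P C) :
    ∀ a ∈ C, 0 < B a a := fun a ha => hP.pos a (hC.1 ha)

lemma IsComponent.eq_of_apply_ne_zero (hB : B.IsSymm) {P C D : Set V} (hC : IsComponent B P C)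
    (hD : IsComponent B P D) {v w : V} (hv : v ∈ Submodule.span ℝ C)
    (hw : w ∈ Submodule.span ℝ D) (h : B v w ≠ 0) : C = D := by
  by_contra hne
  exact h (hC.orthogonal hB hD hne hv hw)

/-- If vectors `v` and `w` of nonzero norm and their sum lie in the spans of components `C`, `D` and
`E`, then `C = D`; if the sum has nonzero norm as well, then also `C = E`. -/
lemma IsComponent.eq_of_add (hB : B.IsSymm) {P C D E : Set V} (hC : IsComponent B P C)
    (hD : IsComponent B P D) (hE : IsComponent B P E) {v w : V} (hv : v ∈ Submodule.span ℝ C)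
    (hw : w ∈ Submodule.span ℝ D) (hvw : v + w ∈ Submodule.span ℝ E) (hv0 : B v v ≠ 0)
    (hw0 : B w w ≠ 0) : C = D ∧ (B (v + w) (v + w) ≠ 0 → C = E) := by
  have hs : B w v = B v w := hB.eq w v
  by_cases hCD : C = D
  · refine ⟨hCD, fun h => ?_⟩
    subst hCD
    exact hC.eq_of_apply_ne_zero hB hE (Submodule.add_mem _ hv hw) hvw h
  · exfalso
    have h0 := hC.orthogonal hB hD hCD hv hw
    have h1 : C = E := hC.eq_of_apply_ne_zero hB hE hv hvw (by rw [map_add, h0, add_zero]; exact hv0)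
    have h2 : D = E := hD.eq_of_apply_ne_zero hB hE hw hvw
      (by rw [map_add, hs, h0, zero_add]; exact hw0)
    exact hCD (h1.trans h2.symm)

lemma IsImagRoot.apply_self {P : Set V} {v : V} (hv : IsImagRoot B P v) : B v v = 0 := by
  obtain ⟨-, C, -, hvC, h⟩ := hv
  exact apply_eq_zero_of_mem_span h (mem_span_of_mem_closure hvC)

lemma isRealRoot_of_mem_rootSet {P : Set V} {v : V} (hv : v ∈ rootSet B P) (h : B v v ≠ 0) :
    IsRealRoot B P v :=
  hv.resolve_right fun hi => h hi.apply_self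

lemma isImagRoot_of_mem_rootSet (hB : B.IsSymm) {P : Set V} (hP : ∀ a ∈ P, 0 < B a a) {v : V}
    (hv : v ∈ rootSet B P) (h : B v v = 0) : IsImagRoot B P v :=
  hv.resolve_left fun hr => (hr.pos hB hP).ne' h

lemma IsSimpleSystem.isImagRoot_of_null (hB : B.IsSymm) {P C : Set V} (hP : IsSimpleSystem B P)
    (hC : IsComponent B P C) {v : V} (hv : v ∈ AddSubgroup.closure C) (hv0 : v ≠ 0)
    (h : B v v = 0) : IsImagRoot B P v :=
  ⟨hv0, C, hC, hv, fun _ ha => eq_zero_of_null hB (hP.semidefinite C hC)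
    (mem_span_of_mem_closure hv) (Submodule.subset_span ha) h⟩

lemma isCartanBase_of_isIndecomposable (hB : B.IsSymm) {S : Finset V} (hpos : ∀ a ∈ S, 0 < B a a)
    (hnonpos : ∀ a ∈ S, ∀ b ∈ S, a ≠ b → B a b ≤ 0)
    (hint : ∀ a ∈ S, ∀ b ∈ S, ∃ n : ℤ, 2 * B a b = n * B a a)
    (hsemi : ∀ v ∈ Submodule.span ℝ (S : Set V), 0 ≤ B v v)
    (hS : IsIndecomposable B (S : Set V)) : IsCartanBase B S := by
  refine ⟨hpos, hnonpos, hint, hsemi, fun n hn h0 => ?_⟩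
  by_contra! hcon
  obtain ⟨⟨x, hx, hxn⟩, y, hy, hyn⟩ := hcon
  obtain ⟨a, ha, b, hb, hab⟩ := hS.2 {c | c ∈ S ∧ 0 < n c} (fun c hc => hc.1)
    ⟨x, hx, lt_of_le_of_ne (hn x hx) (Ne.symm hxn)⟩ ⟨y, hy, fun h => not_lt.2 hyn h.2⟩
  have hbn : n b = 0 := le_antisymm (not_lt.1 fun h => hb.2 ⟨hb.1, h⟩) (hn b hb.1)
  have h1 := eq_zero_of_null hB hsemi (sum_zsmul_mem_span S n) (Submodule.subset_span hb.1) h0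
  rw [sum_zsmul_apply] at h1
  have h2 := (Finset.sum_eq_zero_iff_of_nonpos fun c hc => ?_).1 h1 a ha.1
  · rcases mul_eq_zero.1 h2 with h3 | h3
    · exact ha.2.ne' (by exact_mod_cast h3)
    · exact hab h3
  · by_cases hcb : c = b
    · rw [hcb, hbn]; simp
    · exact mul_nonpos_of_nonneg_of_nonpos (by exact_mod_cast hn c hc) (hnonpos c hc b hb.1 hcb)

lemma IsSimpleSystem.exists_finset (hB : B.IsSymm) {P C : Set V} (hP : IsSimpleSystem B P)
    (hC : IsComponent B P C) : ∃ S : Finset V, (S : Set V) = C ∧ IsCartanBase B S := by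
  obtain ⟨S, rfl⟩ := (hP.finite.subset hC.1).exists_finset_coe
  exact ⟨S, rfl, isCartanBase_of_isIndecomposable hB (fun a ha => hP.pos a (hC.1 ha))
    (fun a ha b hb => hP.nonpos a (hC.1 ha) b (hC.1 hb))
    (fun a ha b hb => hP.integral a (hC.1 ha) b (hC.1 hb)) (hP.semidefinite _ hC) hC.2.1⟩

/-! ### Subsets of the simple roots -/

omit [Module ℝ V] in
lemma sum_ite_mem_zsmul {S T : Finset V} [DecidableEq V] (hT : T ⊆ S) (n : V → ℤ) :
    ∑ c ∈ S, (if c ∈ T then n c else 0) • c = ∑ c ∈ T, n c • c := by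
  rw [← Finset.sum_subset hT]
  · exact Finset.sum_congr rfl fun c hc => by rw [if_pos hc]
  · intro c _ hc; rw [if_neg hc, zero_smul]

lemma IsCartanBase.mono {S T : Finset V} (hS : IsCartanBase B S) (hT : T ⊆ S) :
    IsCartanBase B T := by
  classical
  refine ⟨fun a ha => hS.pos a (hT ha), fun a ha b hb => hS.nonpos a (hT ha) b (hT hb),
    fun a ha b hb => hS.integral a (hT ha) b (hT hb),
    fun v hv => hS.semidefinite v (Submodule.span_mono (by exact_mod_cast hT) hv), fun n hn h0 => ?_⟩
  rw [← sum_ite_mem_zsmul hT] at h0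
  have hn' : ∀ c ∈ S, 0 ≤ if c ∈ T then n c else 0 := fun c _ => by
    split_ifs with hc
    · exact hn c hc
    · exact le_rfl
  rcases hS.full_support _ hn' h0 with h | h
  · exact .inl fun c hc => by simpa [hc] using h c (hT hc)
  · exact .inr fun c hc => by simpa [hc] using h c (hT hc)

/-- The form has no nonzero null vector in the lattice of a proper subset of the simple roots. -/
lemma IsCartanBase.eq_zero_of_null (hB : B.IsSymm) {S T : Finset V} (hS : IsCartanBase B S)
    (hT : T ⊆ S) (hne : T ≠ S) {v : V} (hv : v ∈ AddSubgroup.closure (T : Set V))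
    (h0 : B v v = 0) : v = 0 := by
  classical
  have hTb := hS.mono hT
  obtain ⟨d, hdS, hdT⟩ : ∃ d ∈ S, d ∉ T := by
    by_contra! h
    exact hne (hT.antisymm h)
  have key : ∀ n : V → ℤ, (∀ c ∈ T, 0 ≤ n c) → B (∑ c ∈ T, n c • c) (∑ c ∈ T, n c • c) = 0 →
      ∑ c ∈ T, n c • c = 0 := by
    intro n hn h
    rw [← sum_ite_mem_zsmul hT] at h
    have hn' : ∀ c ∈ S, 0 ≤ if c ∈ T then n c else 0 := fun c _ => by
      split_ifs with hc
      · exact hn c hc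
      · exact le_rfl
    rcases hS.full_support _ hn' h with h1 | h1
    · refine Finset.sum_eq_zero fun c hc => ?_
      have := h1 c (hT hc)
      rw [if_pos hc] at this
      rw [this, zero_smul]
    · simpa [hdT] using h1 d hdS
  obtain ⟨n, rfl⟩ := mem_closure_finset_iff.1 hv
  have hle := norm_posPart_add_norm_negPart_le hB hTb.nonpos n
  have hp := hTb.semidefinite _ (sum_zsmul_mem_span T fun c => max (n c) 0)
  have hq := hTb.semidefinite _ (sum_zsmul_mem_span T fun c => max (-n c) 0)
  rw [sum_max_sub_sum_max T n, key _ (fun c _ => le_max_right _ _) (by linarith),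
    key _ (fun c _ => le_max_right _ _) (by linarith), sub_zero]

lemma eq_of_sum_zsmul_eq {S : Finset V} (hS : LinearIndepOn ℝ id (S : Set V)) {n m : V → ℤ}
    (h : ∑ c ∈ S, n c • c = ∑ c ∈ S, m c • c) : ∀ c ∈ S, n c = m c := by
  intro c hc
  have h1 := linearIndepOn_finset_iff.1 hS (fun c => ((n c - m c : ℤ) : ℝ)) (by
    simp only [Int.cast_smul_eq_zsmul, sub_smul, Finset.sum_sub_distrib, id, h, sub_self]) c hc
  have h2 : n c - m c = 0 := by exact_mod_cast h1
  linarith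

/-- A real root that is an integral combination of some of the simple roots belongs to the
root system generated by these. -/
lemma IsRealRoot.of_mem_closure (hB : B.IsSymm) {S T : Finset V} (hS : IsCartanBase B S)
    (hlin : LinearIndepOn ℝ id (S : Set V)) (hT : T ⊆ S) {v : V}
    (hv : IsRealRoot B (S : Set V) v) (hvT : v ∈ AddSubgroup.closure (T : Set V)) :
    IsRealRoot B (T : Set V) v := by
  classical
  obtain ⟨n, hn⟩ := hv.exists_isRootCoord hB hS.pos hS.integral
  obtain ⟨m, hm⟩ := mem_closure_finset_iff.1 hvT
  have hnm := eq_of_sum_zsmul_eq hlin (n := n) (m := fun c => if c ∈ T then m c else 0) (by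
    rw [sum_ite_mem_zsmul hT, ← hm, ← hn.eq_sum])
  refine IsRootCoord.isRealRoot hB (hS.mono hT) (n := m) ⟨hn.pos, hm, fun c hc => ?_⟩
  have h1 := hnm c (hT hc)
  rw [if_pos hc] at h1
  rw [← h1]
  exact hn.dual c (hT hc)

lemma IsRealRoot.mem_closure (hB : B.IsSymm) {S : Finset V} (hS : IsCartanBase B S) {v : V}
    (hv : IsRealRoot B (S : Set V) v) : v ∈ AddSubgroup.closure (S : Set V) := by
  obtain ⟨n, hn⟩ := hv.exists_isRootCoord hB hS.pos hS.integral
  exact mem_closure_finset_iff.2 ⟨n, hn.eq_sum⟩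

lemma IsComponent.exists_superset (hB : B.IsSymm) {P P' C' : Set V} (hPP' : P' ⊆ P)
    (hC' : IsComponent B P' C') : ∃ C, IsComponent B P C ∧ C' ⊆ C := by
  obtain ⟨a, ha⟩ := hC'.2.1.1
  obtain ⟨C, hC, haC⟩ := AffineRoots.exists_isComponent hB (hPP' (hC'.1 ha))
  exact ⟨C, hC, hC.subset_of_isIndecomposable hC'.2.1 (hC'.1.trans hPP') ⟨a, ha, haC⟩⟩

lemma IsSimpleSystem.subset (hB : B.IsSymm) {P P' : Set V} (hP : IsSimpleSystem B P)
    (hPP' : P' ⊆ P) (hne : P'.Nonempty) : IsSimpleSystem B P' := by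
  refine ⟨hP.finite.subset hPP', hne, fun a ha => hP.pos a (hPP' ha),
    fun a ha b hb => hP.nonpos a (hPP' ha) b (hPP' hb),
    fun a ha b hb => hP.integral a (hPP' ha) b (hPP' hb), fun C' hC' => ?_, fun C' hC' v hv => ?_⟩
  · obtain ⟨C, hC, h⟩ := hC'.exists_superset hB hPP'
    exact (hP.linearIndep C hC).mono h
  · obtain ⟨C, hC, h⟩ := hC'.exists_superset hB hPP'
    exact hP.semidefinite C hC v (Submodule.span_mono h hv)

lemma rootSet_mono (hB : B.IsSymm) {P P' : Set V} (hP : IsSimpleSystem B P)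
    (hPP' : P' ⊆ P) : rootSet B P' ⊆ rootSet B P := by
  rintro v (hv | hv)
  · exact .inl (hv.mono hPP')
  · have h0 := hv.apply_self
    obtain ⟨hv0, C', hC', hvC', -⟩ := hv
    obtain ⟨C, hC, h⟩ := hC'.exists_superset hB hPP'
    exact .inr (hP.isImagRoot_of_null hB hC (AddSubgroup.closure_mono h hvC') hv0 h0)

/-- The root system generated by a nonempty subset of the simple roots is closed under sums of
real roots: by the criterion in terms of root coordinates, a root of the big system that lies in
the lattice of the subset is a root of the small one. -/
lemma add_mem_rootSet_of_subset (hB : B.IsSymm) {P P' : Set V} (hP : IsSimpleSystem B P)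
    (hPP' : P' ⊆ P) {v w : V} (hv : IsRealRoot B P' v) (hw : IsRealRoot B P' w)
    (hvw : v + w ∈ rootSet B P) : v + w ∈ rootSet B P' := by
  have hpos' : ∀ a ∈ P', 0 < B a a := fun a ha => hP.pos a (hPP' ha)
  have hvpos := hv.pos hB hpos'
  have hwpos := hw.pos hB hpos'
  obtain ⟨C₁', hC₁', hv⟩ := hv.exists_isComponent hB
  obtain ⟨C₂', hC₂', hw⟩ := hw.exists_isComponent hB
  obtain ⟨C₁, hC₁, h₁⟩ := hC₁'.exists_superset hB hPP'
  obtain ⟨C₂, hC₂, h₂⟩ := hC₂'.exists_superset hB hPP'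
  have hv₁ := hv.mono h₁
  have hw₂ := hw.mono h₂
  obtain ⟨E, hE, hvwE⟩ : ∃ E, IsComponent B P E ∧ v + w ∈ Submodule.span ℝ E := by
    rcases hvw with h | ⟨-, E, hE, h, -⟩
    · obtain ⟨E, hE, h⟩ := h.exists_isComponent hB
      exact ⟨E, hE, h.mem_span⟩
    · exact ⟨E, hE, mem_span_of_mem_closure h⟩
  obtain ⟨rfl, hCE⟩ := hC₁.eq_of_add hB hC₂ hE hv₁.mem_span hw₂.mem_span hvwE hvpos.ne' hwpos.ne'
  obtain ⟨S, hSC, hS⟩ := hP.exists_finset hB hC₁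
  have hlin := hP.linearIndep _ hC₁
  -- the part of the component that survives in the subset
  obtain ⟨T, hT⟩ := (S.finite_toSet.inter_of_left P').exists_finset_coe
  have hTS : T ⊆ S := by
    rw [← Finset.coe_subset, hT]; exact Set.inter_subset_left
  have hTP' : (T : Set V) ⊆ P' := by rw [hT]; exact Set.inter_subset_right
  have hsub : ∀ D ⊆ P', D ⊆ C₁ → D ⊆ (T : Set V) := fun D hD h => by
    rw [hT]; exact Set.subset_inter (by rwa [hSC]) hD
  have hmem : v + w ∈ AddSubgroup.closure (T : Set V) :=
    add_mem ((hv.mono (hsub _ hC₁'.1 h₁)).mem_closure hB (hS.mono hTS))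
      ((hw.mono (hsub _ hC₂'.1 h₂)).mem_closure hB (hS.mono hTS))
  by_cases h0 : B (v + w) (v + w) = 0
  · have hi := isImagRoot_of_mem_rootSet hB hP.pos hvw h0
    have hTeq : T = S := by
      by_contra hne
      exact hi.1 (hS.eq_zero_of_null hB hTS hne hmem h0)
    subst hTeq
    have hC₁P' : C₁ ⊆ P' := by rw [← hSC]; exact hTP'
    have hcomp : IsComponent B P' C₁ :=
      ⟨hC₁P', hC₁.2.1, fun a ha b hb => hC₁.2.2 a ha b ⟨hPP' hb.1, hb.2⟩⟩
    refine .inr ((hP.subset hB hPP' (hC₁.2.1.1.mono hC₁P')).isImagRoot_of_null hB hcomp ?_ hi.1 h0)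
    rwa [← hSC]
  · obtain ⟨E', hE', hr⟩ := (isRealRoot_of_mem_rootSet hvw h0).exists_isComponent hB
    obtain rfl : C₁ = E' := (hC₁.eq_of_add hB hC₁ hE' hv₁.mem_span hw₂.mem_span hr.mem_span
      hvpos.ne' hwpos.ne').2 h0
    rw [← hSC] at hr hlin
    exact .inl ((hr.of_mem_closure hB hS hlin hTS hmem).mono hTP')

lemma IsRealRoot.nonempty {P : Set V} {v : V} (hv : IsRealRoot B P v) : P.Nonempty := by
  induction hv with
  | simple ha => exact ⟨_, ha⟩
  | reflect ha _ _ => exact ⟨_, ha⟩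

lemma DiscardsAffineNodes.subset {P P' : Set V} (h : DiscardsAffineNodes B P P') : P' ⊆ P := by
  obtain ⟨J, node, -, rfl⟩ := h
  exact Set.sdiff_subset

lemma DiscardsAffineNodes.nonempty {P P' : Set V} (hP : P.Nonempty)
    (h : DiscardsAffineNodes B P P') : P'.Nonempty := by
  obtain ⟨J, node, hJ, rfl⟩ := h
  obtain ⟨a, ha⟩ := hP
  by_cases haJ : a ∈ node '' J
  · obtain ⟨C, hC, rfl⟩ := haJ
    obtain ⟨hcomp, -, t, ht, -⟩ := hJ C hC
    obtain ⟨b, hb, hbne⟩ := ht.1.nonempty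
    refine ⟨b, hcomp.1 hb, ?_⟩
    rintro ⟨D, hD, rfl⟩
    obtain ⟨hDcomp, hDmem, -⟩ := hJ D hD
    exact hbne (by rw [hcomp.eq_of_mem hDcomp hb hDmem]; rfl)
  · exact ⟨a, ha, haJ⟩

/-- Discarding nodes from the simple roots of a root subsystem leaves the simple roots of a root
subsystem.  That the discarded nodes are affine matters only in that some simple root is left. -/
theorem isRootSubsystem_of_discardsAffineNodes (hB : B.IsSymm) {Δ P P' : Set V}
    (hP : IsSimpleSystem B P) (hsub : IsRootSubsystem B (rootSet B P) Δ)
    (h : DiscardsAffineNodes B P P') :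
    IsSimpleSystem B P' ∧ IsRootSubsystem B (rootSet B P') Δ := by
  have hss := h.subset
  have hP' := hP.subset hB hss (h.nonempty hP.nonempty)
  have hmono := rootSet_mono hB hP hss
  refine ⟨hP', ⟨P', hP', rfl⟩, hmono.trans hsub.subset, fun a ha b hb ha0 hb0 hab => ?_⟩
  exact add_mem_rootSet_of_subset hB hP hss (isRealRoot_of_mem_rootSet ha ha0)
    (isRealRoot_of_mem_rootSet hb hb0) (hsub.closed a (hmono ha) b (hmono hb) ha0 hb0 hab)

/-! ### Translations by null vectors -/

lemma exists_real_coord {S : Finset V} {v : V} (hv : v ∈ Submodule.span ℝ (S : Set V)) :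
    ∃ r : V → ℝ, v = ∑ c ∈ S, r c • c := by
  obtain ⟨r, -, hr⟩ := Submodule.mem_span_finset.1 hv
  exact ⟨r, hr.symm⟩

/-- An affine component has a null vector in its root lattice: the Cartan matrix is singular over
`ℝ`, hence over `ℤ`. -/
lemma exists_null_mem_closure (hB : B.IsSymm) {S : Finset V} (hS : IsCartanBase B S)
    (hlin : LinearIndepOn ℝ id (S : Set V)) (haff : IsAffineType B (S : Set V)) :
    ∃ n : V → ℤ, ∑ c ∈ S, n c • c ≠ 0 ∧ ∀ c ∈ S, B (∑ c ∈ S, n c • c) c = 0 := by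
  classical
  obtain ⟨v, hv, hv0, hvv⟩ := haff
  obtain ⟨r, hr⟩ := exists_real_coord hv
  choose! e he using hS.integral
  let A : Matrix S S ℤ := fun c d => e c d
  have hvc : ∀ c ∈ S, B c v = 0 := fun c hc => by
    rw [hB.eq c v]
    exact eq_zero_of_null hB hS.semidefinite hv (Submodule.subset_span hc) hvv
  have hdet : (A.map (Int.castRingHom ℝ)).det = 0 := by
    refine Matrix.exists_mulVec_eq_zero_iff.1 ⟨fun c => r c, fun h => hv0 ?_, ?_⟩
    · rw [hr]
      exact Finset.sum_eq_zero fun c hc => by rw [show r c = 0 from congrFun h ⟨c, hc⟩, zero_smul]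
    · funext c
      have h1 : (∑ d ∈ S, (e c d : ℝ) * r d) * B c c = 0 := by
        have h2 := hvc c c.2
        rw [hr, map_sum] at h2
        rw [Finset.sum_mul, ← mul_zero (2 : ℝ), ← h2, Finset.mul_sum]
        refine Finset.sum_congr rfl fun d hd => ?_
        rw [map_smul, smul_eq_mul]
        linear_combination (-r d) * he c c.2 d hd
      have h3 := (mul_eq_zero.1 h1).resolve_right (hS.pos c c.2).ne'
      rw [← Finset.sum_coe_sort] at h3
      exact h3
  have hdet' : A.det = 0 := by
    have h1 := (Int.castRingHom ℝ).map_det A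
    rw [RingHom.mapMatrix_apply, hdet] at h1
    simpa using h1
  obtain ⟨n, hn0, hn⟩ := Matrix.exists_mulVec_eq_zero_iff.2 hdet'
  let n' : V → ℤ := fun c => if h : c ∈ S then n ⟨c, h⟩ else 0
  have hn' : ∀ c : S, n' c = n c := fun c => by simp [n']
  refine ⟨n', fun h => hn0 ?_, fun c hc => ?_⟩
  · funext c
    have := eq_of_sum_zsmul_eq hlin (n := n') (m := fun _ => 0) (by simpa using h) c c.2
    rw [← hn' c, this]; rfl
  · have h1 : ∑ d : S, e c d * n' d = 0 := by
      have := congrFun hn ⟨c, hc⟩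
      simp only [Matrix.mulVec, dotProduct, A, Pi.zero_apply] at this
      simpa [hn'] using this
    rw [Finset.sum_coe_sort S (fun d => e c d * n' d)] at h1
    have h2 : (2 : ℝ) * B (∑ c ∈ S, n' c • c) c = (∑ d ∈ S, e c d * n' d : ℤ) * B c c := by
      rw [hB.eq _ c, apply_sum_zsmul, Finset.mul_sum]
      push_cast
      rw [Finset.sum_mul]
      refine Finset.sum_congr rfl fun d hd => ?_
      linear_combination (n' d : ℝ) * he c hc d hd
    rw [h1, Int.cast_zero, zero_mul] at h2
    linarith

/-- The norms of the simple roots of an indecomposable system are commensurable. -/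
lemma exists_norm_ratio (hB : B.IsSymm) {S : Finset V} (hS : IsCartanBase B S)
    (hind : IsIndecomposable B (S : Set V)) :
    ∃ N : ℤ, N ≠ 0 ∧ ∀ c ∈ S, ∀ d ∈ S, ∃ m : ℤ, N * B c c = m * B d d := by
  have key : ∀ c ∈ S, ∀ d ∈ S, ∃ p : ℤ, p ≠ 0 ∧ ∃ q : ℤ, p * B c c = q * B d d := by
    intro c hc d hd
    by_contra hcon
    obtain ⟨a, ⟨ha, p, hp, q, hpq⟩, b, ⟨hb, hb'⟩, hab⟩ :=
      hind.2 {x | x ∈ S ∧ ∃ p : ℤ, p ≠ 0 ∧ ∃ q : ℤ, p * B x x = q * B d d} (fun x hx => hx.1)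
        ⟨d, hd, 1, one_ne_zero, 1, rfl⟩ ⟨c, hc, fun h => hcon h.2⟩
    obtain ⟨e, he⟩ := hS.integral a ha b hb
    obtain ⟨f, hf⟩ := hS.integral b hb a ha
    rw [hB.eq b a] at hf
    have hf0 : f ≠ 0 := by
      rintro rfl
      rw [Int.cast_zero, zero_mul] at hf
      exact hab (by linarith)
    refine hb' ⟨hb, p * f, mul_ne_zero hp hf0, e * q, ?_⟩
    push_cast
    linear_combination (-(p : ℝ)) * hf + (p : ℝ) * he + (e : ℝ) * hpq
  choose! p hp0 q hpq using key
  refine ⟨∏ c ∈ S, ∏ d ∈ S, p c d,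
    Finset.prod_ne_zero_iff.2 fun c hc => Finset.prod_ne_zero_iff.2 fun d hd => hp0 c hc d hd,
    fun c hc d hd => ?_⟩
  obtain ⟨k, hk⟩ : p c d ∣ ∏ c ∈ S, ∏ d ∈ S, p c d :=
    (Finset.dvd_prod_of_mem (p c) hd).trans
      (Finset.dvd_prod_of_mem (fun c => ∏ d ∈ S, p c d) hc)
  refine ⟨k * q c d, ?_⟩
  rw [hk]
  push_cast
  linear_combination (k : ℝ) * hpq c hc d hd

/-- Some multiple `ε` of the null root of an affine component is a period of its real roots. -/
lemma exists_period (hB : B.IsSymm) {S : Finset V} (hS : IsCartanBase B S)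
    (hlin : LinearIndepOn ℝ id (S : Set V)) (hind : IsIndecomposable B (S : Set V))
    (haff : IsAffineType B (S : Set V)) :
    ∃ ε ∈ AddSubgroup.closure (S : Set V), ε ≠ 0 ∧
      (∀ w ∈ Submodule.span ℝ (S : Set V), B ε w = 0) ∧
      ∀ v, IsRealRoot B (S : Set V) v → ∀ j : ℤ, IsRealRoot B (S : Set V) (v + j • ε) := by
  obtain ⟨n, hn0, hn⟩ := exists_null_mem_closure hB hS hlin haff
  obtain ⟨N, hN0, hN⟩ := exists_norm_ratio hB hS hind
  have hsum : N • ∑ c ∈ S, n c • c = ∑ c ∈ S, (N * n c) • c := by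
    rw [Finset.smul_sum]; exact Finset.sum_congr rfl fun c _ => by rw [mul_smul]
  have hnull : ∀ w ∈ Submodule.span ℝ (S : Set V), B (N • ∑ c ∈ S, n c • c) w = 0 := by
    intro w hw
    rw [map_zsmul, LinearMap.smul_apply, apply_eq_zero_of_mem_span hn hw, smul_zero]
  refine ⟨N • ∑ c ∈ S, n c • c, zsmul_mem (sum_zsmul_mem_closure S n) _, ?_, hnull,
    fun v hv j => ?_⟩
  · rw [← Int.cast_smul_eq_zsmul ℝ]
    exact smul_ne_zero (by exact_mod_cast hN0) hn0
  · obtain ⟨k, hk⟩ := hv.exists_isRootCoord hB hS.pos hS.integral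
    obtain ⟨d, hd, hvd⟩ := hv.apply_self hB hS.pos
    have hnorm : ∀ ε : V, (∀ w ∈ Submodule.span ℝ (S : Set V), B ε w = 0) →
        ε ∈ Submodule.span ℝ (S : Set V) → B (v + j • ε) (v + j • ε) = B v v := by
      intro ε h hε
      simp only [map_add, LinearMap.add_apply, map_zsmul, LinearMap.smul_apply, h v hv.mem_span,
        h ε hε, hB.eq v ε, smul_zero, add_zero]
    have hnorm' := hnorm _ hnull
      (mem_span_of_mem_closure (zsmul_mem (sum_zsmul_mem_closure S n) _))
    refine IsRootCoord.isRealRoot hB hS (n := fun c => k c + j * (N * n c))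
      ⟨by rw [hnorm']; exact hk.pos, ?_, fun c hc => ?_⟩
    · simp only [add_smul, Finset.sum_add_distrib, ← hk.eq_sum, hsum, Finset.smul_sum, mul_smul]
    · obtain ⟨m, hm⟩ := hk.dual c hc
      obtain ⟨m', hm'⟩ := hN c hc d hd
      refine ⟨m + j * n c * m', ?_⟩
      rw [hnorm']
      push_cast
      rw [hvd] at hm ⊢
      linear_combination hm + (j * n c : ℝ) * hm'

/-! ### Highest roots of finite type -/

/-- An indecomposable set of simple roots of finite type. -/
structure IsFiniteBase (B : LinearMap.BilinForm ℝ V) (S : Finset V) : Prop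
    extends IsCartanBase B S where
  linearIndep : LinearIndepOn ℝ id (S : Set V)
  indecomposable : IsIndecomposable B (S : Set V)
  definite : ∀ v ∈ Submodule.span ℝ (S : Set V), B v v = 0 → v = 0

omit [Module ℝ V] in
lemma mem_addSubmonoid_closure_finset_iff {S : Finset V} {v : V} :
    v ∈ AddSubmonoid.closure (S : Set V) ↔
      ∃ n : V → ℤ, (∀ c ∈ S, 0 ≤ n c) ∧ v = ∑ c ∈ S, n c • c := by
  classical
  constructor
  · intro h
    induction h using AddSubmonoid.closure_induction with
    | mem a ha =>
      refine ⟨Pi.single a 1, fun c _ => ?_, ?_⟩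
      · by_cases hca : c = a
        · subst hca; simp
        · simp [Pi.single_eq_of_ne hca]
      · rw [Finset.sum_eq_single a]
        · simp
        · intro b _ hb; simp [Pi.single_eq_of_ne hb]
        · exact fun h => absurd ha h
    | zero => exact ⟨0, fun _ _ => le_rfl, by simp⟩
    | add x y _ _ hx hy =>
      obtain ⟨p, hp, rfl⟩ := hx
      obtain ⟨q, hq, rfl⟩ := hy
      exact ⟨p + q, fun c hc => add_nonneg (hp c hc) (hq c hc), by
        simp [add_smul, Finset.sum_add_distrib]⟩
  · rintro ⟨n, hn, rfl⟩
    refine sum_mem fun c hc => ?_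
    rw [← Int.toNat_of_nonneg (hn c hc), natCast_zsmul]
    exact nsmul_mem (AddSubmonoid.subset_closure hc) _

/-- The height (sum of the coordinates) is `(ρ, ·)` for a suitable vector `ρ`, as the form is
nondegenerate. -/
lemma IsFiniteBase.exists_height {S : Finset V} (hS : IsFiniteBase B S) :
    ∃ ρ ∈ Submodule.span ℝ (S : Set V), ∀ c ∈ S, B ρ c = 1 := by
  let T : (S → ℝ) →ₗ[ℝ] (S → ℝ) :=
    { toFun := fun r c => B (∑ d : S, r d • (d : V)) c
      map_add' := fun r s => by
        funext c; simp [add_smul, Finset.sum_add_distrib]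
      map_smul' := fun t r => by
        funext c
        simp only [Pi.smul_apply, smul_eq_mul, mul_smul, ← Finset.smul_sum, map_smul,
          LinearMap.smul_apply, RingHom.id_apply] }
  have hmem : ∀ r : S → ℝ, ∑ d : S, r d • (d : V) ∈ Submodule.span ℝ (S : Set V) := fun r =>
    sum_mem fun d _ => Submodule.smul_mem _ _ (Submodule.subset_span d.2)
  have hinj : Function.Injective T := by
    rw [← LinearMap.ker_eq_bot, LinearMap.ker_eq_bot']
    intro r hr
    have h0 : B (∑ d : S, r d • (d : V)) (∑ d : S, r d • (d : V)) = 0 :=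
      apply_eq_zero_of_mem_span (fun c hc => congrFun hr ⟨c, hc⟩) (hmem r)
    have h1 := hS.definite _ (hmem r) h0
    have h2 := Fintype.linearIndependent_iff.1 (show LinearIndependent ℝ (fun d : S => (d : V)) from
      hS.linearIndep) r h1
    exact funext h2
  obtain ⟨r, hr⟩ := LinearMap.injective_iff_surjective.1 hinj (fun _ => 1)
  exact ⟨_, hmem r, fun c hc => congrFun hr ⟨c, hc⟩⟩

lemma height_eq_sum {S : Finset V} {ρ : V} (hρ : ∀ c ∈ S, B ρ c = 1) (n : V → ℤ) :
    B ρ (∑ c ∈ S, n c • c) = (∑ c ∈ S, n c : ℤ) := by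
  rw [apply_sum_zsmul]
  push_cast
  exact Finset.sum_congr rfl fun c hc => by rw [hρ c hc, mul_one]

/-- The heights of the real roots are bounded, by the Cauchy--Schwarz inequality; so every nonempty
set of real roots has an element of largest height. -/
lemma IsFiniteBase.exists_max_height (hB : B.IsSymm) {S : Finset V} (hS : IsFiniteBase B S) {ρ : V}
    (hρS : ρ ∈ Submodule.span ℝ (S : Set V)) (hρ : ∀ c ∈ S, B ρ c = 1) {Q : V → Prop} {u : V}
    (hu : IsRealRoot B (S : Set V) u) (hQ : Q u) :
    ∃ v, IsRealRoot B (S : Set V) v ∧ Q v ∧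
      ∀ w, IsRealRoot B (S : Set V) w → Q w → B ρ w ≤ B ρ v := by
  have hheight : ∀ w, IsRealRoot B (S : Set V) w → ∃ k : ℤ, B ρ w = k := fun w hw => by
    obtain ⟨n, hn⟩ := hw.exists_isRootCoord hB hS.pos hS.integral
    exact ⟨_, by rw [hn.eq_sum, height_eq_sum hρ]⟩
  have hbdd : ∀ w, IsRealRoot B (S : Set V) w → B ρ w ≤ B ρ ρ * (∑ c ∈ S, B c c) + 1 := by
    intro w hw
    have h1 := sq_le_mul_of_semidefinite hB hS.semidefinite hρS hw.mem_span
    obtain ⟨d, hd, hwd⟩ := hw.apply_self hB hS.pos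
    have h2 : B d d ≤ ∑ c ∈ S, B c c :=
      Finset.single_le_sum (f := fun c => B c c) (fun c hc => (hS.pos c hc).le) hd
    have h3 := mul_le_mul_of_nonneg_left h2 (hS.semidefinite ρ hρS)
    rw [hwd] at h1
    -- `t ≤ t ^ 2 + 1` for the height `t`
    nlinarith [sq_nonneg (B ρ w - 1)]
  obtain ⟨b, hb⟩ := exists_int_gt (B ρ ρ * (∑ c ∈ S, B c c) + 1)
  obtain ⟨k, ⟨v, hv, hQv, hk⟩, hmax⟩ := Int.exists_greatest_of_bdd
    (P := fun k : ℤ => ∃ v, IsRealRoot B (S : Set V) v ∧ Q v ∧ B ρ v = k)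
    ⟨b, fun k ⟨v, hv, _, hk⟩ => by
      have := hbdd v hv
      rw [hk] at this
      exact_mod_cast (this.trans_lt hb).le⟩
    (by obtain ⟨k, hk⟩ := hheight u hu; exact ⟨k, u, hu, hQ, hk⟩)
  refine ⟨v, hv, hQv, fun w hw hQw => ?_⟩
  obtain ⟨l, hl⟩ := hheight w hw
  rw [hl, hk]
  exact_mod_cast hmax l ⟨w, hw, hQw, hl⟩

/-- A root of largest height in a class of roots that is stable under those simple reflections
that increase the height is dominant. -/
lemma IsFiniteBase.exists_dominant (hB : B.IsSymm) {S : Finset V} (hS : IsFiniteBase B S) {ρ : V}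
    (hρS : ρ ∈ Submodule.span ℝ (S : Set V)) (hρ : ∀ c ∈ S, B ρ c = 1) {Q : V → Prop}
    (hstable : ∀ w, IsRealRoot B (S : Set V) w → Q w → ∀ c ∈ S, B w c < 0 → Q (reflect B c w))
    {u : V} (hu : IsRealRoot B (S : Set V) u) (hQ : Q u) :
    ∃ v, IsRealRoot B (S : Set V) v ∧ Q v ∧ (∀ c ∈ S, 0 ≤ B v c) ∧
      ∀ w, IsRealRoot B (S : Set V) w → Q w → B ρ w ≤ B ρ v := by
  obtain ⟨v, hv, hQv, hmax⟩ := hS.exists_max_height hB hρS hρ hu hQ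
  refine ⟨v, hv, hQv, fun c hc => ?_, hmax⟩
  by_contra! hneg
  have h1 := hmax _ (.reflect hc hv) (hstable v hv hQv c hc hneg)
  rw [reflect, map_sub, map_smul, hρ c hc, smul_eq_mul, mul_one] at h1
  have h2 : 2 * B v c / B c c < 0 := div_neg_of_neg_of_pos (by linarith) (hS.pos c hc)
  linarith

/-- A dominant root is a positive combination of all simple roots. -/
lemma IsFiniteBase.coord_pos_of_dominant (hB : B.IsSymm) {S : Finset V} (hS : IsFiniteBase B S)
    {v : V} {n : V → ℤ} (hn : IsRootCoord B S v n) (hdom : ∀ c ∈ S, 0 ≤ B v c) :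
    ∀ c ∈ S, 0 < n c := by
  have hvv : 0 < ∑ c ∈ S, n c * B v c := by
    rw [← apply_sum_zsmul, ← hn.eq_sum]; exact hn.pos
  have hnn : ∀ c ∈ S, 0 ≤ n c := by
    refine (hn.nonneg_or_nonpos hB hS.toIsCartanBase).resolve_right fun h => ?_
    exact not_lt.2 (Finset.sum_nonpos fun c hc =>
      mul_nonpos_of_nonpos_of_nonneg (by exact_mod_cast h c hc) (hdom c hc)) hvv
  obtain ⟨x, hx, hxn⟩ : ∃ x ∈ S, 0 < n x := by
    by_contra! hcon
    exact not_lt.2 (Finset.sum_nonpos fun c hc =>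
      mul_nonpos_of_nonpos_of_nonneg (by exact_mod_cast hcon c hc) (hdom c hc)) hvv
  by_contra! hcon
  obtain ⟨y, hy, hyn⟩ := hcon
  obtain ⟨a, ha, b, hb, hab⟩ := hS.indecomposable.2 {c | c ∈ S ∧ 0 < n c} (fun c hc => hc.1)
    ⟨x, hx, hxn⟩ ⟨y, hy, fun h => not_lt.2 hyn h.2⟩
  have hbn : n b = 0 := le_antisymm (not_lt.1 fun h => hb.2 ⟨hb.1, h⟩) (hnn b hb.1)
  have hterm : ∀ c ∈ S, (n c : ℝ) * B c b ≤ 0 := fun c hc => by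
    by_cases hcb : c = b
    · rw [hcb, hbn]; simp
    · exact mul_nonpos_of_nonneg_of_nonpos (by exact_mod_cast hnn c hc)
        (hS.nonpos c hc b hb.1 hcb)
  have h1 := hdom b hb.1
  rw [hn.eq_sum, sum_zsmul_apply] at h1
  have h2 := (Finset.sum_eq_zero_iff_of_nonpos hterm).1
    (le_antisymm (Finset.sum_nonpos hterm) h1) a ha.1
  rcases mul_eq_zero.1 h2 with h3 | h3
  · exact ha.2.ne' (by exact_mod_cast h3)
  · exact hab h3

lemma IsFiniteBase.apply_pos_of_dominant (hB : B.IsSymm) {S : Finset V} (hS : IsFiniteBase B S)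
    {v w : V} (hv : IsRealRoot B (S : Set V) v) (hw : IsRealRoot B (S : Set V) w)
    (hvdom : ∀ c ∈ S, 0 ≤ B v c) (hwdom : ∀ c ∈ S, 0 ≤ B w c) : 0 < B v w := by
  obtain ⟨n, hn⟩ := hw.exists_isRootCoord hB hS.pos hS.integral
  have hnpos := hS.coord_pos_of_dominant hB hn hwdom
  have hterm : ∀ c ∈ S, 0 ≤ (n c : ℝ) * B v c := fun c hc =>
    mul_nonneg (by exact_mod_cast (hnpos c hc).le) (hvdom c hc)
  rw [hn.eq_sum, apply_sum_zsmul]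
  refine lt_of_le_of_ne (Finset.sum_nonneg hterm) fun h => ?_
  have h0 := (Finset.sum_eq_zero_iff_of_nonneg hterm).1 h.symm
  refine (hv.pos hB hS.pos).ne' (apply_eq_zero_of_mem_span (fun c hc => ?_) hv.mem_span)
  exact (mul_eq_zero.1 (h0 c hc)).resolve_left (by exact_mod_cast (hnpos c hc).ne')

lemma IsFiniteBase.height_ne_zero (hB : B.IsSymm) {S : Finset V} (hS : IsFiniteBase B S) {ρ : V}
    (hρ : ∀ c ∈ S, B ρ c = 1) {v : V} (hv : IsRealRoot B (S : Set V) v) : B ρ v ≠ 0 := by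
  obtain ⟨n, hn⟩ := hv.exists_isRootCoord hB hS.pos hS.integral
  intro h0
  have h1 : ∑ c ∈ S, n c = 0 := by
    rw [hn.eq_sum, height_eq_sum hρ] at h0; exact_mod_cast h0
  have h2 : ∀ c ∈ S, n c = 0 := by
    rcases hn.nonneg_or_nonpos hB hS.toIsCartanBase with h | h
    · exact (Finset.sum_eq_zero_iff_of_nonneg h).1 h1
    · exact (Finset.sum_eq_zero_iff_of_nonpos h).1 h1
  have h3 : v = 0 := by
    rw [hn.eq_sum]; exact Finset.sum_eq_zero fun c hc => by rw [h2 c hc, zero_smul]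
  have h4 := hn.pos
  simp [h3] at h4

/-- Two real roots `v`, `w` with `0 < (v, w)` are equal, or their difference is a real root. -/
lemma IsFiniteBase.eq_or_sub (hB : B.IsSymm) {S : Finset V} (hS : IsFiniteBase B S) {v w : V}
    (hv : IsRealRoot B (S : Set V) v) (hw : IsRealRoot B (S : Set V) w) (hvw : 0 < B v w) :
    v = w ∨ IsRealRoot B (S : Set V) (v - w) := by
  obtain ⟨n, hn⟩ := hv.exists_isRootCoord hB hS.pos hS.integral
  obtain ⟨m, hm⟩ := hw.exists_isRootCoord hB hS.pos hS.integral
  have hs : B w v = B v w := hB.eq w v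
  obtain ⟨p, hp⟩ := hn.exists_int hS.integral (hw.mem_closure hB hS.toIsCartanBase)
  obtain ⟨q, hq⟩ := hm.exists_int hS.integral (hv.mem_closure hB hS.toIsCartanBase)
  rw [hs] at hq
  have hp0 : 0 < p := by
    have : (0 : ℝ) < p * B v v := by rw [← hp]; linarith
    exact_mod_cast pos_of_mul_pos_left this hn.pos.le
  have hq0 : 0 < q := by
    have : (0 : ℝ) < q * B w w := by rw [← hq]; linarith
    exact_mod_cast pos_of_mul_pos_left this hm.pos.le
  by_cases hq1 : q = 1
  · right
    have h := hw.reflect_root hB hS.pos hv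
    rwa [reflect, hq, mul_div_assoc, div_self hm.pos.ne', hq1, Int.cast_one, one_mul,
      one_smul] at h
  by_cases hp1 : p = 1
  · right
    have h := (hv.reflect_root hB hS.pos hw).neg hS.pos
    rwa [reflect, hs, hp, mul_div_assoc, div_self hn.pos.ne', hp1, Int.cast_one, one_mul,
      one_smul, neg_sub] at h
  left
  have hp2 : (2 : ℝ) ≤ p := by exact_mod_cast (by omega : 2 ≤ p)
  have hq2 : (2 : ℝ) ≤ q := by exact_mod_cast (by omega : 2 ≤ q)
  have h1 := mul_le_mul_of_nonneg_right hp2 hn.pos.le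
  have h2 := mul_le_mul_of_nonneg_right hq2 hm.pos.le
  have hmem := Submodule.sub_mem _ hv.mem_span hw.mem_span
  have h3 : B (v - w) (v - w) = B v v + B w w - 2 * B v w := by
    simp only [map_sub, LinearMap.sub_apply, hs]; ring
  exact sub_eq_zero.1 (hS.definite _ hmem (le_antisymm (by linarith) (hS.semidefinite _ hmem)))

/-- In finite type a root `θ` of largest height is the highest root.  For a dominant root `v` above
a given root `u` one has `0 < (θ, v)`, so `θ - v` is zero or a root.  A root is positive or negative,
and comparing heights excludes both. -/
theorem IsFiniteBase.exists_isHighestRoot (hB : B.IsSymm) {S : Finset V} (hS : IsFiniteBase B S) :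
    ∃ θ, IsHighestRoot B (S : Set V) θ ∧ ∀ c ∈ S, 0 ≤ B θ c := by
  obtain ⟨ρ, hρS, hρ⟩ := hS.exists_height
  obtain ⟨a, ha⟩ := hS.indecomposable.1
  obtain ⟨θ, hθ, -, hθdom, hθmax⟩ := hS.exists_dominant hB hρS hρ (Q := fun _ => True)
    (fun _ _ _ _ _ _ => trivial) (.simple ha) trivial
  refine ⟨θ, ⟨hθ, fun u hu => ?_⟩, hθdom⟩
  obtain ⟨v, hv, hvu, hvdom, hvmax⟩ := hS.exists_dominant hB hρS hρ
    (Q := fun w => w - u ∈ AddSubmonoid.closure (S : Set V))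
    (fun w hw hwu c hc hneg => by
      obtain ⟨n, hn⟩ := hw.exists_isRootCoord hB hS.pos hS.integral
      classical
      obtain ⟨p, hp, -⟩ := hn.reflect hB hS.pos hS.integral hc
      have hp0 : p ≤ 0 := by
        by_contra! h
        have h1 : (0 : ℝ) < p * B c c := mul_pos (by exact_mod_cast h) (hS.pos c hc)
        linarith
      have h1 : reflect B c w - u = (w - u) + (-p).toNat • c := by
        rw [← natCast_zsmul, Int.toNat_of_nonneg (by omega), reflect, hp, mul_div_assoc,
          div_self (hS.pos c hc).ne', mul_one, Int.cast_smul_eq_zsmul, neg_smul]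
        abel
      rw [h1]
      exact add_mem hwu (nsmul_mem (AddSubmonoid.subset_closure hc) _))
    hu (by rw [sub_self]; exact zero_mem _)
  rcases hS.eq_or_sub hB hθ hv (hS.apply_pos_of_dominant hB hθ hv hθdom hvdom) with h | h
  · rwa [h]
  · exfalso
    have hne := hS.height_ne_zero hB hρ h
    have h1 := hθmax v hv trivial
    obtain ⟨n, hn⟩ := h.exists_isRootCoord hB hS.pos hS.integral
    rcases hn.nonneg_or_nonpos hB hS.toIsCartanBase with h0 | h0
    · have h2 : θ - v ∈ AddSubmonoid.closure (S : Set V) :=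
        mem_addSubmonoid_closure_finset_iff.2 ⟨n, h0, hn.eq_sum⟩
      have h3 := hvmax θ hθ (by rw [← sub_add_sub_cancel θ v u]; exact add_mem h2 hvu)
      rw [map_sub] at hne
      exact hne (by linarith)
    · have h2 : B ρ (θ - v) ≤ 0 := by
        rw [hn.eq_sum, height_eq_sum hρ]
        exact_mod_cast Finset.sum_nonpos h0
      rw [map_sub] at hne h2
      exact hne (by linarith)

lemma apply_nonneg_of_mem_closure {S : Set V} {v w : V} (hv : ∀ c ∈ S, 0 ≤ B v c)
    (hw : w ∈ AddSubmonoid.closure S) : 0 ≤ B v w := by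
  induction hw using AddSubmonoid.closure_induction with
  | mem c hc => exact hv c hc
  | zero => simp
  | add x y _ _ hx hy => rw [map_add]; exact add_nonneg hx hy

/-- The norm of the highest root is an integral multiple of the norm of each root. -/
lemma IsFiniteBase.norm_highestRoot (hB : B.IsSymm) {S : Finset V} (hS : IsFiniteBase B S) {θ v : V}
    (hθ : IsHighestRoot B (S : Set V) θ) (hθdom : ∀ c ∈ S, 0 ≤ B θ c)
    (hv : IsRealRoot B (S : Set V) v) : ∃ k : ℤ, B θ θ = k * B v v := by
  obtain ⟨ρ, hρS, hρ⟩ := hS.exists_height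
  -- it suffices to treat a dominant root of the same norm
  obtain ⟨w, hw, hwv, hwdom, -⟩ := hS.exists_dominant hB hρS hρ (Q := fun w => B w w = B v v)
    (fun w _ hw c hc _ => by rw [apply_reflect_reflect hB (hS.pos c hc).ne', hw]) hv rfl
  have hθw := hS.apply_pos_of_dominant hB hθ.1 hw hθdom hwdom
  have hs : B w θ = B θ w := hB.eq w θ
  obtain ⟨n, hn⟩ := hθ.1.exists_isRootCoord hB hS.pos hS.integral
  obtain ⟨m, hm⟩ := hw.exists_isRootCoord hB hS.pos hS.integral
  obtain ⟨p, hp⟩ := hn.exists_int hS.integral (hw.mem_closure hB hS.toIsCartanBase)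
  obtain ⟨q, hq⟩ := hm.exists_int hS.integral (hθ.1.mem_closure hB hS.toIsCartanBase)
  have hle := hθ.2 w hw
  have h1 := apply_nonneg_of_mem_closure hθdom hle
  have h2 := apply_nonneg_of_mem_closure hwdom hle
  rw [map_sub, sub_nonneg] at h1 h2
  rw [hs] at h2 hq
  have hp0 : 0 < p := by
    have : (0 : ℝ) < p * B θ θ := by rw [← hp]; linarith
    exact_mod_cast pos_of_mul_pos_left this hn.pos.le
  by_cases hp1 : p = 1
  · refine ⟨q, ?_⟩
    rw [hp1, Int.cast_one, one_mul] at hp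
    rw [← hwv, ← hp, hq]
  · have hp2 : (2 : ℝ) ≤ p := by exact_mod_cast (by omega : 2 ≤ p)
    have h3 := mul_le_mul_of_nonneg_right hp2 hn.pos.le
    have hmem := Submodule.sub_mem _ hθ.1.mem_span hw.mem_span
    have h4 : B (θ - w) (θ - w) = B θ θ + B w w - 2 * B θ w := by
      simp only [map_sub, LinearMap.sub_apply, hs]; ring
    have h5 := sub_eq_zero.1
      (hS.definite _ hmem (le_antisymm (by linarith) (hS.semidefinite _ hmem)))
    exact ⟨1, by rw [h5, hwv]; simp⟩

/-! ### Extending a component to an affine one -/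

/-- `D` is an affine set of simple roots that either equals `F`, or is the untwisted affine
extension of `F` by one node; its real roots are the translates of those of `F` by multiples
of `e`.  (For `D = F` affine, `e = 0`.) -/
structure IsAffineHull (B : LinearMap.BilinForm ℝ V) (F : Set V) (e : V) (D : Set V) : Prop where
  base : ∃ S : Finset V, (S : Set V) = D ∧ IsCartanBase B S
  linearIndep : LinearIndepOn ℝ id D
  indecomposable : IsIndecomposable B D
  affine : IsAffineType B D
  isRealRoot_iff : ∀ v, IsRealRoot B D v ↔ ∃ b, IsRealRoot B F b ∧ ∃ j : ℤ, v = b + j • e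
  eq_or_insert : D = F ∨ ∃ a, D = insert a F ∧ a ∉ F ∧ IsUntwistedWithNode B D a

lemma IsSimpleSystem.isAffineHull_self (hB : B.IsSymm) {Q F : Set V} (hQ : IsSimpleSystem B Q)
    (hF : IsComponent B Q F) (haff : IsAffineType B F) : IsAffineHull B F 0 F := by
  refine ⟨hQ.exists_finset hB hF, hQ.linearIndep F hF, hF.2.1, haff, fun v => ⟨fun h => ?_, ?_⟩,
    .inl rfl⟩
  · exact ⟨v, h, 0, by simp⟩
  · rintro ⟨b, hb, j, rfl⟩
    simpa using hb

lemma IsSimpleSystem.exists_isFiniteBase (hB : B.IsSymm) {Q F : Set V} (hQ : IsSimpleSystem B Q)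
    (hF : IsComponent B Q F) (haff : ¬ IsAffineType B F) :
    ∃ S : Finset V, (S : Set V) = F ∧ IsFiniteBase B S := by
  obtain ⟨S, rfl, hS⟩ := hQ.exists_finset hB hF
  refine ⟨S, rfl, hS, hQ.linearIndep _ hF, hF.2.1, fun v hv h0 => ?_⟩
  by_contra hne
  exact haff ⟨v, hv, hne, h0⟩

/-- Let `ε` be a nonzero null vector orthogonal to a finite system with highest root `θ`.  Adding
`ε - θ` gives an untwisted affine system with real roots `b + j ε`.  All these translates occur,
because `(θ, θ) / (b, b)` is an integer, so that `b + j ε` has integral coroot coordinates. -/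
theorem IsFiniteBase.exists_isAffineHull (hB : B.IsSymm) {S : Finset V} (hS : IsFiniteBase B S)
    {ε : V} (hε0 : ε ≠ 0) (hεε : B ε ε = 0) (hεS : ∀ w ∈ Submodule.span ℝ (S : Set V), B ε w = 0) :
    ∃ D, IsAffineHull B (S : Set V) ε D := by
  classical
  obtain ⟨θ, hθ, hθdom⟩ := hS.exists_isHighestRoot hB
  have hθS := hθ.1.mem_span
  have hθpos := hθ.1.pos hB hS.pos
  have hεS' : ∀ w ∈ Submodule.span ℝ (S : Set V), B w ε = 0 := fun w hw => by
    rw [hB.eq w ε]; exact hεS w hw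
  have hεspan : ε ∉ Submodule.span ℝ (S : Set V) := fun h => hε0 (hS.definite ε h hεε)
  set α := ε - θ with hα
  have hαspan : α ∉ Submodule.span ℝ (S : Set V) := fun h => hεspan (by
    have := Submodule.add_mem _ h hθS
    rwa [hα, sub_add_cancel] at this)
  have hαS : α ∉ S := fun h => hαspan (Submodule.subset_span h)
  have hαw : ∀ w ∈ Submodule.span ℝ (S : Set V), B α w = -B θ w := fun w hw => by
    rw [hα, map_sub, LinearMap.sub_apply, hεS w hw, zero_sub]
  have hwα : ∀ w ∈ Submodule.span ℝ (S : Set V), B w α = -B w θ := fun w hw => by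
    rw [hα, map_sub, hεS' w hw, zero_sub]
  have hαα : B α α = B θ θ := by
    simp only [hα, map_sub, LinearMap.sub_apply, hεε, hεS θ hθS, hεS' θ hθS]; ring
  have hεα : ∀ w ∈ Submodule.span ℝ (insert α (S : Set V)), B ε w = 0 := fun w hw => by
    refine apply_eq_zero_of_mem_span (fun c hc => ?_) hw
    rcases hc with rfl | hc
    · rw [hα, map_sub, hεε, hεS θ hθS, sub_zero]
    · exact hεS c (Submodule.subset_span hc)
  have hspan : ∀ c ∈ S, c ∈ Submodule.span ℝ (S : Set V) := fun c hc => Submodule.subset_span hc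
  obtain ⟨n, hn⟩ := hθ.1.exists_isRootCoord hB hS.pos hS.integral
  have hind : IsIndecomposable B (insert α (S : Set V)) := by
    obtain ⟨c, hc, hcθ⟩ : ∃ c ∈ S, B α c ≠ 0 := by
      by_contra! hcon
      refine hθpos.ne' (apply_eq_zero_of_mem_span (fun c hc => ?_) hθS)
      have := hcon c hc
      rw [hαw c (hspan c hc)] at this
      linarith
    refine ⟨⟨α, Set.mem_insert _ _⟩, fun T hT hTne hTc => ?_⟩
    by_contra! hcon
    by_cases h1 : ((S : Set V) ∩ T).Nonempty
    · by_cases h2 : ((S : Set V) \ ((S : Set V) ∩ T)).Nonempty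
      · obtain ⟨a, ha, b, hb, hab⟩ := hS.indecomposable.2 _ Set.inter_subset_left h1 h2
        exact hab (hcon a ha.2 b ⟨Set.mem_insert_of_mem _ hb.1, fun h => hb.2 ⟨hb.1, h⟩⟩)
      · -- all of `S` lies in `T`, so `α` does not
        have hST : ∀ x ∈ S, x ∈ T := fun x hx => by
          by_contra h
          exact h2 ⟨x, hx, fun h' => h h'.2⟩
        obtain ⟨y, hy, hyT⟩ := hTc
        have hyα : y = α := hy.resolve_right fun h => hyT (hST y h)
        subst hyα
        exact hcθ (by rw [hB.eq α c]; exact hcon c (hST c hc) α ⟨hy, hyT⟩)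
    · have hST : ∀ x ∈ S, x ∉ T := fun x hx h => h1 ⟨x, hx, h⟩
      obtain ⟨y, hy⟩ := hTne
      have hyα : y = α := (hT hy).resolve_right fun h => hST y h hy
      subst hyα
      exact hcθ (hcon α hy c ⟨Set.mem_insert_of_mem _ hc, hST c hc⟩)
  have hbase : IsCartanBase B (insert α S) := by
    refine isCartanBase_of_isIndecomposable hB ?_ ?_ ?_ ?_ (by rwa [Finset.coe_insert])
    · intro a ha
      rcases Finset.mem_insert.1 ha with rfl | ha
      · rw [hαα]; exact hθpos
      · exact hS.pos a ha
    · intro a ha b hb hab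
      rcases Finset.mem_insert.1 ha with rfl | ha <;> rcases Finset.mem_insert.1 hb with rfl | hb
      · exact absurd rfl hab
      · rw [hαw b (hspan b hb)]; linarith [hθdom b hb]
      · rw [hwα a (hspan a ha), hB.eq a θ]; linarith [hθdom a ha]
      · exact hS.nonpos a ha b hb hab
    · intro a ha b hb
      rcases Finset.mem_insert.1 ha with rfl | ha <;> rcases Finset.mem_insert.1 hb with rfl | hb
      · exact ⟨2, by push_cast; ring⟩
      · obtain ⟨q, hq⟩ := hn.exists_int hS.integral (AddSubgroup.subset_closure hb)
        refine ⟨-q, ?_⟩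
        rw [hαw b (hspan b hb), hαα]; push_cast; linear_combination -hq
      · obtain ⟨p, hp, -⟩ := hn.reflect hB hS.pos hS.integral ha
        refine ⟨-p, ?_⟩
        rw [hwα a (hspan a ha), hB.eq a θ]; push_cast; linear_combination -hp
      · exact hS.integral a ha b hb
    · intro v hv
      rw [Finset.coe_insert] at hv
      obtain ⟨t, x, hx, rfl⟩ := Submodule.mem_span_insert.1 hv
      have h1 := hS.semidefinite _ (Submodule.sub_mem _ hx (Submodule.smul_mem _ t hθS))
      have h2 : B (t • α + x) (t • α + x) = B (x - t • θ) (x - t • θ) := by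
        simp only [map_add, map_sub, map_smul, LinearMap.add_apply, LinearMap.sub_apply,
          LinearMap.smul_apply, smul_eq_mul, hαα, hαw x hx, hwα x hx]
        ring
      rwa [h2]
  have hεmem : ε ∈ Submodule.span ℝ (insert α (S : Set V)) := by
    have h1 : ε = α + θ := by rw [hα, sub_add_cancel]
    rw [h1]
    exact Submodule.add_mem _ (Submodule.subset_span (Set.mem_insert _ _))
      (Submodule.span_mono (Set.subset_insert _ _) hθS)
  refine ⟨insert α (S : Set V), ⟨insert α S, Finset.coe_insert _ _, hbase⟩,
    hS.linearIndep.id_insert hαspan, hind, ⟨ε, hεmem, hε0, hεε⟩, fun v => ⟨fun hv => ?_, ?_⟩,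
    .inr ⟨α, rfl, hαS, Set.mem_insert _ _, θ, ?_, fun c hc => ?_⟩⟩
  · induction hv with
    | @simple a ha =>
      rcases ha with rfl | ha
      · exact ⟨-θ, hθ.1.neg hS.pos, 1, by rw [hα, one_smul]; abel⟩
      · exact ⟨a, .simple ha, 0, by simp⟩
    | @reflect a v ha _ ih =>
      obtain ⟨b, hb, j, rfl⟩ := ih
      have hBv : ∀ w ∈ Submodule.span ℝ (insert α (S : Set V)), B (b + j • ε) w = B b w :=
        fun w hw => by
          rw [map_add, LinearMap.add_apply, map_zsmul, LinearMap.smul_apply, hεα w hw, smul_zero,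
            add_zero]
      rcases ha with rfl | ha
      · -- on the span of `S`, the reflection in `α` is the reflection in `θ`
        obtain ⟨p, hp⟩ := hn.exists_int hS.integral (hb.mem_closure hB hS.toIsCartanBase)
        refine ⟨reflect B θ b, hθ.1.reflect_root hB hS.pos hb, j + p, ?_⟩
        rw [reflect, reflect, hBv α (Submodule.subset_span (Set.mem_insert _ _)), hαα,
          hwα b hb.mem_span, hB.eq b θ, mul_neg, neg_div, hp, mul_div_assoc, div_self hθpos.ne',
          mul_one, neg_smul, Int.cast_smul_eq_zsmul, Int.cast_smul_eq_zsmul, hα, add_smul,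
          smul_sub]
        abel
      · refine ⟨reflect B a b, .reflect ha hb, j, ?_⟩
        rw [reflect, reflect,
          hBv a (Submodule.subset_span (Set.mem_insert_of_mem _ ha))]
        abel
  · rintro ⟨b, hb, j, rfl⟩
    obtain ⟨k, hk⟩ := hS.norm_highestRoot hB hθ hθdom hb
    obtain ⟨m, hm⟩ := hb.exists_isRootCoord hB hS.pos hS.integral
    have hnorm : B (b + j • ε) (b + j • ε) = B b b := by
      simp only [map_add, map_zsmul, LinearMap.add_apply, LinearMap.smul_apply, hεε,
        hεS b hb.mem_span, hεS' b hb.mem_span, smul_zero, add_zero]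
    have hne : ∀ c ∈ S, c ≠ α := fun c hc h => hαS (h ▸ hc)
    rw [← Finset.coe_insert]
    refine IsRootCoord.isRealRoot hB hbase (n := fun c => if c = α then j else m c + j * n c)
      ⟨by rw [hnorm]; exact hm.pos, ?_, fun c hc => ?_⟩
    · have h1 : ∑ c ∈ S, (if c = α then j else m c + j * n c) • c = b + j • θ := by
        rw [hm.eq_sum, hn.eq_sum, Finset.smul_sum, ← Finset.sum_add_distrib]
        refine Finset.sum_congr rfl fun c hc => ?_
        rw [if_neg (hne c hc), add_smul, mul_smul]
      rw [Finset.sum_insert hαS, h1, if_pos rfl, hα, smul_sub]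
      abel
    · rw [hnorm]
      rcases Finset.mem_insert.1 hc with rfl | hc
      · refine ⟨j * k, ?_⟩
        rw [if_pos rfl, hαα, hk]; push_cast; ring
      · obtain ⟨x, hx⟩ := hm.dual c hc
        obtain ⟨y, hy⟩ := hn.dual c hc
        refine ⟨x + j * y * k, ?_⟩
        rw [if_neg (hne c hc)]
        push_cast
        linear_combination hx + (j : ℝ) * hy + (j * y : ℝ) * hk
  · rwa [Set.insert_sdiff_of_mem _ (Set.mem_singleton α), Set.sdiff_singleton_eq_self hαS]
  · have h1 : α + θ = ε := by rw [hα, sub_add_cancel]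
    rw [h1]
    exact hεα c (Submodule.subset_span hc)

/-! ### The affine envelope of a root subsystem -/

/-- A component of a subsystem lies in one component of the root system. -/
lemma IsComponent.exists_ambient (hB : B.IsSymm) {P Q F : Set V} (hP : IsSimpleSystem B P)
    (hQ : IsSimpleSystem B Q) (hsub : rootSet B Q ⊆ rootSet B P) (hF : IsComponent B Q F) :
    ∃ C, IsComponent B P C ∧ ∀ v, IsRealRoot B F v → IsRealRoot B C v := by
  have hreal : ∀ a ∈ F, IsRealRoot B P a := fun a ha =>
    isRealRoot_of_mem_rootSet (hsub (.inl (.simple (hF.1 ha)))) (hQ.pos a (hF.1 ha)).ne'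
  obtain ⟨a, ha⟩ := hF.2.1.1
  obtain ⟨C, hC, haC⟩ := (hreal a ha).exists_isComponent hB
  have hall : ∀ x ∈ F, IsRealRoot B C x := by
    intro x hx
    by_contra hcon
    obtain ⟨y, hy, z, hz, hyz⟩ := hF.2.1.2 {x | x ∈ F ∧ IsRealRoot B C x} (fun x hx => hx.1)
      ⟨a, ha, haC⟩ ⟨x, hx, fun h => hcon h.2⟩
    obtain ⟨E, hE, hzE⟩ := (hreal z hz.1).exists_isComponent hB
    obtain rfl := hC.eq_of_apply_ne_zero hB hE hy.2.mem_span hzE.mem_span hyz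
    exact hz.2 ⟨hz.1, hzE⟩
  refine ⟨C, hC, fun v hv => ?_⟩
  induction hv with
  | simple ha => exact hall _ ha
  | reflect ha _ ih => exact (hall _ ha).reflect_root hB (hC.pos hP) ih

/-- Every component of a subsystem of an affine root system has an affine hull whose translation
vector is a period of the ambient component. -/
lemma IsComponent.exists_isAffineHull (hB : B.IsSymm) {P Q F : Set V} (hP : IsSimpleSystem B P)
    (haff : ∀ C, IsComponent B P C → IsAffineType B C)
    (hQ : IsSimpleSystem B Q) (hsub : rootSet B Q ⊆ rootSet B P) (hF : IsComponent B Q F) :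
    ∃ D e C, IsAffineHull B F e D ∧ IsComponent B P C ∧
      (∀ v, IsRealRoot B F v → IsRealRoot B C v) ∧
      e ∈ Submodule.span ℝ C ∧ (∀ w ∈ Submodule.span ℝ C, B e w = 0) ∧
      ∀ v, IsRealRoot B C v → ∀ j : ℤ, IsRealRoot B C (v + j • e) := by
  obtain ⟨C, hC, hFC⟩ := hF.exists_ambient hB hP hQ hsub
  by_cases hFaff : IsAffineType B F
  · exact ⟨F, 0, C, hQ.isAffineHull_self hB hF hFaff, hC, hFC, zero_mem _, by simp, by simp⟩
  · obtain ⟨S, rfl, hS⟩ := hQ.exists_isFiniteBase hB hF hFaff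
    obtain ⟨T, rfl, hT⟩ := hP.exists_finset hB hC
    obtain ⟨ε, hε, hε0, hεT, hper⟩ := exists_period hB hT (hP.linearIndep _ hC) hC.2.1 (haff _ hC)
    have hεspan := mem_span_of_mem_closure hε
    obtain ⟨D, hD⟩ := hS.exists_isAffineHull hB hε0 (hεT ε hεspan) fun w hw =>
      hεT w (Submodule.span_le.2 (fun c hc => (hFC c (.simple hc)).mem_span) hw)
    exact ⟨D, ε, T, hD, hC, hFC, hεspan, hεT, hper⟩

/-- Every subsystem of an affine root system arises by discarding affine nodes from an affine
subsystem.  Closedness of the envelope is inherited: translating a sum of two of its roots by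
periods of the ambient system gives a sum of two roots of the given subsystem. -/
theorem exists_affine_envelope (hB : B.IsSymm) {P Q : Set V} (hP : IsSimpleSystem B P)
    (haff : ∀ C, IsComponent B P C → IsAffineType B C)
    (hQ : IsSimpleSystem B Q) (hsub : IsRootSubsystem B (rootSet B Q) (rootSet B P)) :
    ∃ R, IsSimpleSystem B R ∧ (∀ D, IsComponent B R D → IsAffineType B D) ∧
      IsRootSubsystem B (rootSet B R) (rootSet B P) ∧ DiscardsAffineNodes B R Q := by
  have hex := fun F (hF : IsComponent B Q F) =>
    hF.exists_isAffineHull hB hP haff hQ hsub.subset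
  choose! D e κ hD hκ hreal heκ he hper using hex
  have hcover : ∀ {q}, q ∈ Q → ∃ F, IsComponent B Q F ∧ q ∈ F := fun hq => exists_isComponent hB hq
  have hFD : ∀ F, IsComponent B Q F → F ⊆ D F := fun F hF => by
    rcases (hD F hF).eq_or_insert with h | ⟨a, h, -⟩
    · exact h.ge
    · rw [h]; exact Set.subset_insert _ _
  have hDκ : ∀ F, IsComponent B Q F → ∀ v, IsRealRoot B (D F) v → IsRealRoot B (κ F) v := by
    intro F hF v hv
    obtain ⟨b, hb, j, rfl⟩ := ((hD F hF).isRealRoot_iff v).1 hv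
    exact hper F hF b (hreal F hF b hb) j
  -- the translation vectors are orthogonal to all roots
  have he0 : ∀ F, IsComponent B Q F → ∀ G, IsComponent B Q G →
      ∀ v ∈ Submodule.span ℝ (κ G), B (e F) v = 0 := by
    intro F hF G hG v hv
    by_cases h : κ F = κ G
    · exact he F hF v (by rwa [h])
    · exact (hκ F hF).orthogonal hB (hκ G hG) h (heκ F hF) hv
  have hpair : ∀ F, IsComponent B Q F → ∀ G, IsComponent B Q G → ∀ b, IsRealRoot B F b →
      ∀ c, IsRealRoot B G c → ∀ i j : ℤ, B (b + i • e F) (c + j • e G) = B b c := by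
    intro F hF G hG b hb c hc i j
    have h1 := he0 F hF G hG c (hreal G hG c hc).mem_span
    have h2 := he0 G hG F hF b (hreal F hF b hb).mem_span
    have h3 := he0 F hF G hG (e G) (heκ G hG)
    rw [hB.eq (e G) b] at h2
    simp only [map_add, map_zsmul, LinearMap.add_apply, LinearMap.smul_apply, h1, h2, h3,
      smul_zero, add_zero]
  have horth : ∀ F, IsComponent B Q F → ∀ G, IsComponent B Q G → F ≠ G →
      ∀ x, IsRealRoot B (D F) x → ∀ y, IsRealRoot B (D G) y → B x y = 0 := by
    intro F hF G hG hne x hx y hy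
    obtain ⟨b, hb, i, rfl⟩ := ((hD F hF).isRealRoot_iff x).1 hx
    obtain ⟨c, hc, j, rfl⟩ := ((hD G hG).isRealRoot_iff y).1 hy
    rw [hpair F hF G hG b hb c hc]
    exact hF.orthogonal hB hG hne hb.mem_span hc.mem_span
  have hposD : ∀ F, IsComponent B Q F → ∀ a ∈ D F, 0 < B a a := by
    intro F hF a ha
    obtain ⟨S, hS, hbase⟩ := (hD F hF).base
    exact hbase.pos a (by rw [← hS] at ha; exact ha)
  set R : Set V := {x | ∃ F, IsComponent B Q F ∧ x ∈ D F} with hR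
  have hcomp : ∀ F, IsComponent B Q F → IsComponent B R (D F) := by
    refine fun F hF => ⟨fun x hx => ⟨F, hF, hx⟩, (hD F hF).indecomposable, ?_⟩
    rintro a ha b ⟨⟨G, hG, hb⟩, hbF⟩
    have hne : F ≠ G := by rintro rfl; exact hbF hb
    exact horth F hF G hG hne a (.simple ha) b (.simple hb)
  have hcomp' : ∀ E, IsComponent B R E → ∃ F, IsComponent B Q F ∧ E = D F := by
    intro E hE
    obtain ⟨x, hx⟩ := hE.2.1.1
    obtain ⟨F, hF, hxF⟩ := hE.1 hx
    exact ⟨F, hF, hE.eq_of_mem (hcomp F hF) hx hxF⟩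
  have hQR : Q ⊆ R := fun q hq => by
    obtain ⟨F, hF, hqF⟩ := hcover hq
    exact ⟨F, hF, hFD F hF hqF⟩
  have hcases : ∀ a ∈ R, ∀ b ∈ R, B a b = 0 ∨ ∃ S : Finset V, IsCartanBase B S ∧ a ∈ S ∧ b ∈ S := by
    rintro a ⟨F, hF, ha⟩ b ⟨G, hG, hb⟩
    by_cases hne : F = G
    · subst hne
      obtain ⟨S, hS, hbase⟩ := (hD F hF).base
      rw [← hS] at ha hb
      exact .inr ⟨S, hbase, ha, hb⟩
    · exact .inl (horth F hF G hG hne a (.simple ha) b (.simple hb))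
  have hRsimple : IsSimpleSystem B R := by
    refine ⟨?_, hQ.nonempty.mono hQR, ?_, ?_, ?_, ?_, ?_⟩
    · have h1 : {F | IsComponent B Q F}.Finite :=
        hQ.finite.finite_subsets.subset fun F hF => hF.1
      refine (h1.biUnion (t := D) fun F hF => ?_).subset ?_
      · obtain ⟨S, hS, -⟩ := (hD F hF).base
        rw [← hS]; exact S.finite_toSet
      · rintro x ⟨F, hF, hx⟩
        exact Set.mem_biUnion (show F ∈ {F | IsComponent B Q F} from hF) hx
    · rintro a ⟨F, hF, ha⟩
      exact hposD F hF a ha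
    · intro a ha b hb hab
      rcases hcases a ha b hb with h | ⟨S, hS, haS, hbS⟩
      · exact h.le
      · exact hS.nonpos a haS b hbS hab
    · intro a ha b hb
      rcases hcases a ha b hb with h | ⟨S, hS, haS, hbS⟩
      · exact ⟨0, by rw [h]; simp⟩
      · exact hS.integral a haS b hbS
    · intro E hE
      obtain ⟨F, hF, rfl⟩ := hcomp' E hE
      exact (hD F hF).linearIndep
    · intro E hE
      obtain ⟨F, hF, rfl⟩ := hcomp' E hE
      obtain ⟨S, hS, hbase⟩ := (hD F hF).base
      rw [← hS]; exact hbase.semidefinite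
  have hclosure : ∀ F, IsComponent B Q F → ∀ v, IsRealRoot B (D F) v →
      v ∈ AddSubgroup.closure (D F) := by
    intro F hF v hv
    obtain ⟨S, hS, hbase⟩ := (hD F hF).base
    rw [← hS] at hv ⊢
    exact hv.mem_closure hB hbase
  refine ⟨R, hRsimple, fun E hE => ?_, ⟨⟨R, hRsimple, rfl⟩, ?_, ?_⟩, ?_⟩
  · obtain ⟨F, hF, rfl⟩ := hcomp' E hE
    exact (hD F hF).affine
  · rintro v (hv | hv)
    · obtain ⟨E, hE, hv⟩ := hv.exists_isComponent hB
      obtain ⟨F, hF, rfl⟩ := hcomp' E hE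
      exact .inl ((hDκ F hF v hv).mono (hκ F hF).1)
    · have h0 := hv.apply_self
      obtain ⟨hv0, E, hE, hvE, -⟩ := hv
      obtain ⟨F, hF, rfl⟩ := hcomp' E hE
      refine .inr (hP.isImagRoot_of_null hB (hκ F hF) ?_ hv0 h0)
      refine (AddSubgroup.closure_le _).2 (fun x hx => ?_) hvE
      obtain ⟨S, hS, hbase⟩ := hP.exists_finset hB (hκ F hF)
      have h1 := hDκ F hF x (.simple hx)
      rw [← hS] at h1 ⊢
      exact h1.mem_closure hB hbase
  · intro x hx y hy hx0 hy0 hxy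
    obtain ⟨E, hE, hxE⟩ := (isRealRoot_of_mem_rootSet hx hx0).exists_isComponent hB
    obtain ⟨F, hF, rfl⟩ := hcomp' E hE
    obtain ⟨E', hE', hyE⟩ := (isRealRoot_of_mem_rootSet hy hy0).exists_isComponent hB
    obtain ⟨G, hG, rfl⟩ := hcomp' E' hE'
    have hs : B y x = B x y := hB.eq y x
    by_cases hnull : B (x + y) (x + y) = 0
    · have hFG : F = G := by
        by_contra hne
        have h1 := horth F hF G hG hne x hxE y hyE
        have h2 : B (x + y) (x + y) = B x x + B y y := by
          simp only [map_add, LinearMap.add_apply, hs, h1]; ring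
        have h3 := hxE.pos hB (hposD F hF)
        have h4 := hyE.pos hB (hposD G hG)
        linarith
      subst hFG
      exact .inr (hRsimple.isImagRoot_of_null hB hE
        (add_mem (hclosure F hF x hxE) (hclosure F hF y hyE))
        (isImagRoot_of_mem_rootSet hB hP.pos hxy hnull).1 hnull)
    · have hxκ := hDκ F hF x hxE
      have hyκ := hDκ G hG y hyE
      obtain ⟨C, hC, hxyC⟩ := (isRealRoot_of_mem_rootSet hxy hnull).exists_isComponent hB
      obtain ⟨hκFG, hκC⟩ := (hκ F hF).eq_of_add hB (hκ G hG) hC hxκ.mem_span hyκ.mem_span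
        hxyC.mem_span hx0 hy0
      rw [← hκC hnull] at hxyC
      obtain ⟨b, hb, i, rfl⟩ := ((hD F hF).isRealRoot_iff x).1 hxE
      obtain ⟨c, hc, j, rfl⟩ := ((hD G hG).isRealRoot_iff y).1 hyE
      rw [hpair F hF F hF b hb b hb] at hx0
      rw [hpair G hG G hG c hc c hc] at hy0
      have hbc0 : B (b + c) (b + c) ≠ 0 := by
        intro h
        apply hnull
        rw [← h]
        have h1 := hpair F hF F hF b hb b hb i i
        have h2 := hpair F hF G hG b hb c hc i j
        have h3 := hpair G hG F hF c hc b hb j i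
        have h4 := hpair G hG G hG c hc c hc j j
        rw [map_add B, map_add B b c, LinearMap.add_apply, LinearMap.add_apply,
          map_add (B (b + i • e F)), map_add (B (c + j • e G)), h1, h2, h3, h4, map_add (B b),
          map_add (B c)]
      have hbcκ : IsRealRoot B (κ F) (b + c) := by
        have h1 := hper F hF _ hxyC (-i)
        rw [hκFG] at h1
        have h2 := hper G hG _ h1 (-j)
        rw [hκFG]
        have h3 : b + i • e F + (c + j • e G) + -i • e F + -j • e G = b + c := by
          rw [neg_smul, neg_smul]; abel
        rwa [h3] at h2
      have hbcQ := isRealRoot_of_mem_rootSet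
        (hsub.closed b (.inl (hb.mono hF.1)) c (.inl (hc.mono hG.1)) hx0 hy0
          (.inl (hbcκ.mono (hκ F hF).1))) hbc0
      obtain ⟨H, hH, hbcH⟩ := hbcQ.exists_isComponent hB
      obtain ⟨rfl, hFH⟩ := hF.eq_of_add hB hG hH hb.mem_span hc.mem_span hbcH.mem_span hx0 hy0
      obtain rfl := hFH hbc0
      refine .inl (((((hD F hF).isRealRoot_iff _).2 ⟨b + c, hbcH, i + j, ?_⟩)).mono (hcomp F hF).1)
      rw [add_smul]; abel
  · have hinj : ∀ F, IsComponent B Q F → D F ∩ Q = F := by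
      intro F hF
      refine Set.Subset.antisymm ?_ fun q hq => ⟨hFD F hF hq, hF.1 hq⟩
      rintro q ⟨hqF, hqQ⟩
      obtain ⟨G, hG, hqG⟩ := hcover hqQ
      by_cases hne : F = G
      · rwa [hne]
      · exact absurd (horth F hF G hG hne q (.simple hqF) q (.simple (hFD G hG hqG)))
          (hposD F hF q hqF).ne'
    have hnode : ∀ F, ∃ a, IsComponent B Q F → D F ≠ F →
        D F = insert a F ∧ a ∉ F ∧ IsUntwistedWithNode B (D F) a := by
      intro F
      by_cases hF : IsComponent B Q F
      · rcases (hD F hF).eq_or_insert with h | ⟨a, h⟩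
        · exact ⟨0, fun _ h' => absurd h h'⟩
        · exact ⟨a, fun _ _ => h⟩
      · exact ⟨0, fun h => absurd h hF⟩
    choose α hα using hnode
    -- `F` is recovered from `D F` by intersecting with `Q`
    refine ⟨{X | ∃ F, IsComponent B Q F ∧ D F ≠ F ∧ X = D F}, fun X => α (X ∩ Q), ?_, ?_⟩
    · rintro X ⟨F, hF, hne, rfl⟩
      simp only [hinj F hF]
      exact ⟨hcomp F hF, (hα F hF hne).2.2⟩
    · refine Set.Subset.antisymm (fun q hq => ⟨hQR hq, ?_⟩) ?_
      · rintro ⟨X, ⟨F, hF, hne, rfl⟩, rfl⟩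
        simp only [hinj F hF] at hq
        obtain ⟨-, h1, h2, -⟩ := hα F hF hne
        exact h1 ((hinj F hF).subset ⟨h2, hq⟩)
      · rintro x ⟨⟨F, hF, hx⟩, hxn⟩
        by_cases hne : D F = F
        · rw [hne] at hx; exact hF.1 hx
        · have hx' := hx
          rw [(hα F hF hne).1] at hx'
          rcases hx' with rfl | hx'
          · exact absurd ⟨D F, ⟨F, hF, hne, rfl⟩, by simp only [hinj F hF]⟩ hxn
          · exact hF.1 hx'

end AffineRoots

theorem mainTheorem5 {V : Type*} [AddCommGroup V] [Module ℝ V]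
    (B : LinearMap.BilinForm ℝ V) (hB : B.IsSymm)
    (Δ : Set V) (hΔ : AffineRoots.IsAffineRootSystem B Δ) :
    (∀ Δt : Set V, AffineRoots.IsAffineRootSystem B Δt → AffineRoots.IsRootSubsystem B Δt Δ →
      ∀ P P' : Set V, AffineRoots.IsSimpleRootsOf B P Δt →
        AffineRoots.DiscardsAffineNodes B P P' →
        AffineRoots.IsSimpleSystem B P' ∧
          AffineRoots.IsRootSubsystem B (AffineRoots.rootSet B P') Δ) ∧
    (∀ Δ' : Set V, AffineRoots.IsRootSubsystem B Δ' Δ → ¬ AffineRoots.IsAffineRootSystem B Δ' →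
      ∃ Δt : Set V, AffineRoots.IsAffineRootSystem B Δt ∧ AffineRoots.IsRootSubsystem B Δt Δ ∧
        ∃ P P' : Set V, AffineRoots.IsSimpleRootsOf B P Δt ∧
          AffineRoots.DiscardsAffineNodes B P P' ∧
          AffineRoots.IsSimpleRootsOf B P' Δ') := by
  constructor
  · rintro Δt - hsub P P' ⟨hP, rfl⟩ hdisc
    exact AffineRoots.isRootSubsystem_of_discardsAffineNodes hB hP hsub hdisc
  · rintro Δ' hsub -
    obtain ⟨P, ⟨hP, rfl⟩, haff⟩ := hΔ
    obtain ⟨Q, hQ, rfl⟩ := hsub.isRootSystem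
    obtain ⟨R, hR, hRaff, hRsub, hdisc⟩ := AffineRoots.exists_affine_envelope hB hP haff hQ hsub
    exact ⟨AffineRoots.rootSet B R, ⟨R, ⟨hR, rfl⟩, hRaff⟩, hRsub, R, Q, ⟨hR, rfl⟩, hdisc, hQ, rfl⟩
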